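/- Let $(M,g)$ be a smooth Lorentzian four-manifold of signature $(1,3)$, with Weyl tensor $C_{abcd}$. At a point $p\in M$ choose an orthonormal frame of $T_pM$ (equivalently, up to sign, a normalised spin frame for one of the choices of orientation and time orientation), so that tensor indices become pairs of two-component spinor indices, $a=AA'$, and write $C_{abcd}=\psi_{ABCD}\,\epsilon_{A'B'}\epsilon_{C'D'}+\overline{\psi}_{A'B'C'D'}\,\epsilon_{AB}\epsilon_{CD}$, where $\psi_{ABCD}$ is the totally symmetric Weyl spinor. Curvature conventions are $(\nabla_a\nabla_b-\nabla_b\nabla_a)V^d=R_{abc}{}^{d}V^c$; spinor indices are raised by $\xi^A=\epsilon^{AB}\xi_B$ with $\epsilon_{01}=\epsilon^{01}=1$. Put $$I=\psi_{ABCD}\psi^{ABCD},\qquad J=\psi_{AB}{}^{CD}\psi_{CD}{}^{EF}\psi_{EF}{}^{AB}.$$ (1) Let $\epsilon\in\{1,-1\}$. For every $p\in M$ and every such frame at $p$, there exists a real symmetric bilinear form $\sigma_{ab}$ on $T_pM$, trace-free with respect to $g$ and with spinor components $\sigma_{ABA'B'}$, such that $$\sigma_{(AB}{}^{C'D'}\sigma_{CD)C'D'}=-2\epsilon\,\psi_{ABCD}$$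 if and only if $I$ and $J$ are real at $p$. (2) Consequently, if $p\in M$ has an open neighbourhood $U$ which admits a class-one conformal embedding, that is, a smooth embedding $\iota:U\to\mathbb{R}^{r,s}$ into a flat space of signature $(r,s)$, $r+s=5$, with $\iota^*\eta=\Omega^2g$ for some smooth $\Omega:U\to(0,\infty)$, then $I$ and $J$ are real at $p$ (in every such frame). In particular, $I$ and $J$ are real on all of $M$ if $(M,g)$ admits local (or global) class-one conformal embeddings. -/

import Mathlib

open scoped Manifold ContDiff Topology

attribute [local instance 2000] chartedSpaceSelf

noncomputable section

namespace ConfEmb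

/-- The model space `ℝ⁴` of a four-manifold (only its smooth and linear structures are used). -/
abbrev E4 : Type := EuclideanSpace ℝ (Fin 4)

/-- The Minkowski matrix of signature `(1, 3)`, i.e. `diag (1, -1, -1, -1)`. -/
def minkowski : Matrix (Fin 4) (Fin 4) ℝ := Matrix.diagonal ![1, -1, -1, -1]

/-- A smooth Lorentzian metric of signature `(1, 3)` on a smooth four-manifold: a smooth section
of symmetric bilinear forms on the tangent spaces each of which is `diag (1, -1, -1, -1)` in some
basis. -/
structure LorentzMetric (M : Type*) [TopologicalSpace M] [ChartedSpace E4 M]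
    [IsManifold (𝓡 4) ∞ M] where
  inner (p : M) : TangentSpace (𝓡 4) p →L[ℝ] TangentSpace (𝓡 4) p →L[ℝ] ℝ
  symm (p : M) (v w : TangentSpace (𝓡 4) p) : inner p v w = inner p w v
  signature (p : M) : ∃ e : Fin 4 → TangentSpace (𝓡 4) p,
    ∀ i j, inner p (e i) (e j) = minkowski i j
  contMDiff : ContMDiff (𝓡 4) ((𝓡 4).prod 𝓘(ℝ, E4 →L[ℝ] E4 →L[ℝ] ℝ)) ∞
    (fun p ↦ Bundle.TotalSpace.mk' (E4 →L[ℝ] E4 →L[ℝ] ℝ) p (inner p))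

/-! ### Curvature of a metric given by its coordinate components -/

section Coordinates

/-- The coordinate partial derivative `∂ₖ f`. -/
def pd (k : Fin 4) (f : E4 → ℝ) (y : E4) : ℝ :=
  fderiv ℝ f y (EuclideanSpace.single k 1)

variable (G : E4 → Matrix (Fin 4) (Fin 4) ℝ)

/-- The Christoffel symbols `Γᶜ_{ab}` of the Levi-Civita connection. -/
def christoffel (c a b : Fin 4) (y : E4) : ℝ :=
  (1 / 2) * ∑ d, (G y)⁻¹ c d *
    (pd a (fun z ↦ G z d b) y + pd b (fun z ↦ G z a d) y - pd d (fun z ↦ G z a b) y)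

/-- The curvature `R_{abc}{}^d`, in the convention `(∇_a ∇_b - ∇_b ∇_a) V^d = R_{abc}{}^d V^c`. -/
def riemannUp (a b c d : Fin 4) (y : E4) : ℝ :=
  pd a (christoffel G d b c) y - pd b (christoffel G d a c) y +
    ∑ e, (christoffel G d a e y * christoffel G e b c y
      - christoffel G d b e y * christoffel G e a c y)

/-- `R_{abcd} = R_{abc}{}^e g_{ed}`. -/
def riemann (a b c d : Fin 4) (y : E4) : ℝ :=
  ∑ e, riemannUp G a b c e y * G y e d

/-- The Ricci tensor `R_{ab} = R_{acb}{}^c`. -/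
def ricci (a b : Fin 4) (y : E4) : ℝ := ∑ c, riemannUp G a c b c y

/-- The scalar curvature. -/
def scalarCurv (y : E4) : ℝ := ∑ a, ∑ b, (G y)⁻¹ a b * ricci G a b y

/-- The Weyl tensor `C_{abcd}`: the totally trace-free part of `R_{abcd}` in dimension four. -/
def weyl (a b c d : Fin 4) (y : E4) : ℝ :=
  riemann G a b c d y
    - (1 / 2) * (G y a c * ricci G b d y - G y a d * ricci G b c y
        - G y b c * ricci G a d y + G y b d * ricci G a c y)
    + (1 / 6) * scalarCurv G y * (G y a c * G y b d - G y a d * G y b c)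

end Coordinates

/-! ### Weyl spinor and its invariants -/

section Spinors

/-- Arrays of components of two-spinors with four indices. -/
abbrev Spinor4 : Type := Fin 2 → Fin 2 → Fin 2 → Fin 2 → ℂ

/-- The alternating spinor `ε_{AB} = ε^{AB}`, with `ε_{01} = 1`, also used for primed indices.
Indices are raised by `ξ^A = ε^{AB} ξ_B`. -/
def eps : Matrix (Fin 2) (Fin 2) ℂ := !![0, 1; -1, 0]

/-- The Infeld–van der Waerden symbols `σ^a_{AA'}`, relating frame components to spinor components
by `T_{AA'} = σ^a_{AA'} T_a`. -/
def ivdw (a : Fin 4) : Matrix (Fin 2) (Fin 2) ℂ :=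
  ((√2 : ℝ) : ℂ)⁻¹ •
    (![!![1, 0; 0, 1], !![0, 1; 1, 0], !![0, -Complex.I; Complex.I, 0], !![1, 0; 0, -1]] :
      Fin 4 → Matrix (Fin 2) (Fin 2) ℂ) a

/-- Total symmetrisation over four spinor indices. -/
def symmetrize (T : Spinor4) : Spinor4 := fun A B C D ↦
  (1 / 24) * ∑ π : Equiv.Perm (Fin 4),
    T (![A, B, C, D] (π 0)) (![A, B, C, D] (π 1)) (![A, B, C, D] (π 2)) (![A, B, C, D] (π 3))

/-- The spinor form `s_{ABA'B'}` of a tensor `s_{ab}` (index order `A B A' B'`). -/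
def spinorOfTensor (s : Fin 4 → Fin 4 → ℝ) : Spinor4 := fun A B A' B' ↦
  ∑ a, ∑ b, ivdw a A A' * ivdw b B B' * (s a b : ℂ)

/-- `s_{AB}{}^{C'D'} s_{CDC'D'}`. -/
def spinorSquare (s : Spinor4) : Spinor4 := fun A B C D ↦
  ∑ C', ∑ D', (∑ E', ∑ F', eps C' E' * eps D' F' * s A B E' F') * s C D C' D'

/-- The Weyl spinor `ψ_{ABCD} = ¼ C_{AA'BB'CC'DD'} ε^{A'B'} ε^{C'D'}` of a Weyl tensor `C_{abcd}`,
i.e. the unprimed part of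
`C_{abcd} = ψ_{ABCD} ε_{A'B'} ε_{C'D'} + conj(ψ)_{A'B'C'D'} ε_{AB} ε_{CD}`. -/
def weylSpinor (W : Fin 4 → Fin 4 → Fin 4 → Fin 4 → ℝ) : Spinor4 := fun A B C D ↦
  (1 / 4) * ∑ A', ∑ B', ∑ C', ∑ D',
    (∑ a, ∑ b, ∑ c, ∑ d,
      ivdw a A A' * ivdw b B B' * ivdw c C C' * ivdw d D D' * (W a b c d : ℂ))
      * eps A' B' * eps C' D'

/-- `ψ_{AB}{}^{CD}`. -/
def raiseLast (ψ : Spinor4) : Spinor4 := fun A B C D ↦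
  ∑ E, ∑ F, eps C E * eps D F * ψ A B E F

/-- `ψ^{ABCD}`. -/
def raiseAll (ψ : Spinor4) : Spinor4 := fun A B C D ↦
  ∑ E, ∑ F, ∑ G, ∑ H, eps A E * eps B F * eps C G * eps D H * ψ E F G H

/-- The invariant `I = ψ_{ABCD} ψ^{ABCD}`. -/
def invI (ψ : Spinor4) : ℂ := ∑ A, ∑ B, ∑ C, ∑ D, ψ A B C D * raiseAll ψ A B C D

/-- The invariant `J = ψ_{AB}{}^{CD} ψ_{CD}{}^{EF} ψ_{EF}{}^{AB}`. -/
def invJ (ψ : Spinor4) : ℂ :=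
  ∑ A, ∑ B, ∑ C, ∑ D, ∑ E, ∑ F,
    raiseLast ψ A B C D * raiseLast ψ C D E F * raiseLast ψ E F A B

end Spinors

/-! ### The objects attached to a Lorentzian four-manifold -/

namespace LorentzMetric

variable {M : Type*} [TopologicalSpace M] [ChartedSpace E4 M] [IsManifold (𝓡 4) ∞ M]
  (g : LorentzMetric M)

/-- The components `g_{ij}` of the metric in the coordinates of the chart at `p`: the pull-back
of `g` by the inverse of the chart. -/
def chartMetric (p : M) (y : E4) : Matrix (Fin 4) (Fin 4) ℝ := fun i j ↦
  g.inner ((extChartAt (𝓡 4) p).symm y)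
    (mfderiv 𝓘(ℝ, E4) (𝓡 4) (extChartAt (𝓡 4) p).symm y (EuclideanSpace.single i 1))
    (mfderiv 𝓘(ℝ, E4) (𝓡 4) (extChartAt (𝓡 4) p).symm y (EuclideanSpace.single j 1))

/-- The coordinates of a tangent vector at `p` in the chart at `p`. -/
def coords (p : M) (v : TangentSpace (𝓡 4) p) : E4 :=
  mfderiv (𝓡 4) 𝓘(ℝ, E4) (extChartAt (𝓡 4) p) p v

/-- The Weyl tensor of `g` at `p`, evaluated on four tangent vectors. -/
def weylAt (p : M) (u v w z : TangentSpace (𝓡 4) p) : ℝ :=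
  ∑ a, ∑ b, ∑ c, ∑ d, weyl (g.chartMetric p) a b c d (extChartAt (𝓡 4) p p)
    * coords p u a * coords p v b * coords p w c * coords p z d

/-- Orthonormal frames of the tangent space at `p`. -/
def IsOrthonormalFrame (p : M) (e : Fin 4 → TangentSpace (𝓡 4) p) : Prop :=
  ∀ i j, g.inner p (e i) (e j) = minkowski i j

/-- The components `ψ_{ABCD}` of the Weyl spinor of `g` at `p` in the spin frame belonging to the
orthonormal frame `e`. -/
def weylSpinorAt (p : M) (e : Fin 4 → TangentSpace (𝓡 4) p) : Spinor4 :=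
  weylSpinor (fun a b c d ↦ g.weylAt p (e a) (e b) (e c) (e d))

/-- A real symmetric bilinear form `σ` on the tangent space at `p`, trace-free with respect to `g`
(`e` being an orthonormal frame), which satisfies the algebraic Gauss condition
`σ_{(AB}{}^{C'D'} σ_{CD)C'D'} = -2 ε ψ_{ABCD}`. -/
structure SolvesGauss (ε : ℝ) (p : M) (e : Fin 4 → TangentSpace (𝓡 4) p)
    (σ : LinearMap.BilinForm ℝ (TangentSpace (𝓡 4) p)) : Prop where
  symm : ∀ v w, σ v w = σ w v
  traceFree : ∑ i, minkowski i i * σ (e i) (e i) = 0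
  gauss : ∀ A B C D,
    symmetrize (spinorSquare (spinorOfTensor fun a b ↦ σ (e a) (e b))) A B C D
      = -2 * (ε : ℂ) * g.weylSpinorAt p e A B C D

/-- The flat metric of signature `(r, s)` on `ℝ^{r+s}`. -/
def flatMetric (r s : ℕ) (x y : EuclideanSpace ℝ (Fin (r + s))) : ℝ :=
  ∑ i : Fin (r + s), (if (i : ℕ) < r then 1 else -1) * x i * y i

/-- `ι` is a conformally isometric embedding of the open submanifold `U` of `(M, g)` in `ℝ^{r,s}`,
with conformal factor `Ω`: a smooth homeomorphism onto its image with `ι^* η = Ω² g` and `Ω > 0`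
(such an `ι` is an immersion, because `Ω² g` is nondegenerate). -/
structure IsConformalEmbeddingOn (r s : ℕ) (U : Set M)
    (ι : M → EuclideanSpace ℝ (Fin (r + s))) (Ω : M → ℝ) : Prop where
  smooth : ContMDiffOn (𝓡 4) 𝓘(ℝ, EuclideanSpace ℝ (Fin (r + s))) ∞ ι U
  smooth_factor : ContMDiffOn (𝓡 4) 𝓘(ℝ, ℝ) ∞ Ω U
  factor_pos : ∀ x ∈ U, 0 < Ω x
  embedding : Topology.IsEmbedding (U.domRestrict ι)
  pullback : ∀ x ∈ U, ∀ u v : TangentSpace (𝓡 4) x,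
    flatMetric r s (mfderiv (𝓡 4) 𝓘(ℝ, EuclideanSpace ℝ (Fin (r + s))) ι x u)
      (mfderiv (𝓡 4) 𝓘(ℝ, EuclideanSpace ℝ (Fin (r + s))) ι x v) = Ω x ^ 2 * g.inner x u v

/-- Some open neighbourhood of `p` has a conformally isometric embedding in a flat space
`ℝ^{r,s}` of dimension `r + s = 4 + 1`, i.e. of codimension one. -/
def AdmitsClassOneNear (p : M) : Prop :=
  ∃ r s : ℕ, r + s = 5 ∧ ∃ U : Set M, IsOpen U ∧ p ∈ U ∧
    ∃ ι Ω, g.IsConformalEmbeddingOn r s U ι Ω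

end LorentzMetric

end ConfEmb

end

/-! Symmetric spinors `φ_{AB}` form a complex three-space; let N (`symGram`) be the Gram matrix of
`φ_{AB} φ^{AB}`. A trace-free real symmetric tensor is a Hermitian 3×3 matrix H, its spinor square
is H N Hᵀ, and total symmetrisation only alters the multiple of N⁻¹. With Ψ the symmetric matrix of
the Weyl spinor, tr ΨN = 0, I = tr (ΨN)², J = tr (ΨN)³, and the Gauss condition reads H N Hᵀ = -2εΨ
+ t N⁻¹ for some scalar t.

Necessity: conjugation turns (HN)(HᵀN) into (HᵀN)(HN), so the traces of its powers are real
(`trace_im_eq_zero_of_hermitian`). Trace-freeness then makes t real, and I and J are real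
(`im_invariants_eq_zero_of_hermitian`).

Sufficiency: in an N-orthonormal basis the task is to solve H Hᵀ = S + t for a complex symmetric
trace-free S with tr S² and tr S³ real (`exists_hermitian_mul_transpose_of_real_invariants`). The
characteristic polynomial is a real cubic, so S has a real eigenvalue. A non-null eigenvector splits
S into blocks 1 + 2, which are solved explicitly. For a null eigenvector, either another real
eigenvalue has a non-null eigenvector, or S is a single nilpotent Jordan block, solved in a null
frame by `exists_hermitian_of_nilpotent`.

Embeddings: lifting a conformal embedding in ℝ^{r,s} to the null cone of ℝ^{r+1,s+1}, with scale
Ω⁻¹, gives an isometric immersion in a flat seven-space (`coneLift_induced`). Its normal space is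
spanned by the position vector F, a transversal L and one further vector n. The F and L parts of the
second fundamental form contribute to the Gauss equation only products containing the metric
(`exists_normal_decomposition`), so the Weyl tensor is, up to such products, the curvature built
from one symmetric form h. On self-dual bivectors those products act as scalars, and the h-term
becomes a multiple of H N Hᵀ plus a multiple of N⁻¹ (`conj_selfDualMatrix_hypersurface`). The
necessity argument applies again. -/

noncomputable section

namespace ConfEmb

/-! ### Explicit blocks, real congruences and a real root -/

section SymmetricMatrices

open Matrix

/-- A real `2 × 2` matrix with vanishing determinant is an outer product `(x, y) (z, w)`; the
second factor can be taken large compared with the first. -/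
lemma exists_outer_product_of_det_eq_zero (a b c d M : ℝ) (h : a * d = b * c) :
    ∃ x y z w : ℝ, x * z = a ∧ x * w = b ∧ y * z = c ∧ y * w = d ∧
      M ≤ x ^ 2 - y ^ 2 + z ^ 2 + w ^ 2 := by
  obtain ⟨x, y, z, w, h1, h2, h3, h4, h5⟩ : ∃ x y z w : ℝ, x * z = a ∧ x * w = b ∧ y * z = c ∧
      y * w = d ∧ 0 < z ^ 2 + w ^ 2 := by
    by_cases ha : a = 0 ∧ b = 0
    · obtain ⟨rfl, rfl⟩ := ha
      by_cases hc : c = 0 ∧ d = 0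
      · obtain ⟨rfl, rfl⟩ := hc
        exact ⟨0, 0, 1, 0, by simp, by simp, by simp, by simp, by norm_num⟩
      · refine ⟨0, 1, c, d, by simp, by simp, by simp, by simp, ?_⟩
        by_contra! hn
        exact hc ⟨by nlinarith [sq_nonneg c, sq_nonneg d], by nlinarith [sq_nonneg c, sq_nonneg d]⟩
    · by_cases ha0 : a = 0
      · subst ha0
        have hb : b ≠ 0 := fun hb ↦ ha ⟨rfl, hb⟩
        have hc : c = 0 := by
          have : b * c = 0 := by linarith
          exact (mul_eq_zero.mp this).resolve_left hb
        exact ⟨1, d / b, 0, b, by simp, by simp, by simp [hc], by field_simp, by positivity⟩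
      · refine ⟨1, c / a, a, b, by simp, by simp, by field_simp, ?_, by positivity⟩
        field_simp
        linarith
  -- Dividing (x, y) by k and multiplying (z, w) by k preserves all four products, and for large k
  -- makes the quadratic expression as large as desired.
  obtain ⟨k, hk1, hk⟩ : ∃ k : ℝ, 1 ≤ k ∧ |M| + y ^ 2 ≤ k * (z ^ 2 + w ^ 2) := by
    refine ⟨max 1 ((|M| + y ^ 2) / (z ^ 2 + w ^ 2)), le_max_left _ _, ?_⟩
    rw [← div_le_iff₀ h5]
    exact le_max_right _ _
  have hk0 : k ≠ 0 := by positivity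
  refine ⟨x / k, y / k, k * z, k * w, by field_simp; linarith, by field_simp; linarith,
    by field_simp; linarith, by field_simp; linarith, ?_⟩
  have e1 : (y / k) ^ 2 ≤ y ^ 2 := by
    rw [div_pow]
    exact div_le_self (sq_nonneg y) (one_le_pow₀ hk1)
  have e2 : k * (z ^ 2 + w ^ 2) ≤ (k * z) ^ 2 + (k * w) ^ 2 := by
    nlinarith [mul_nonneg (mul_nonneg (by linarith : (0:ℝ) ≤ k) (by linarith : (0:ℝ) ≤ k - 1)) h5.le]
  nlinarith [sq_nonneg (x / k), le_abs_self M]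

/-- For a Hermitian 2×2 block h with diagonal (x ± z)/2 and off-diagonal entry (v - iy)/2, the
trace-free part of h hᵀ is bilinear in (x, y) and (z, v). Reality of u² + w² is exactly the
vanishing determinant that makes the resulting equations solvable. The remaining diagonal entry is a
square root, real once the trace of h hᵀ is large; the size bound on the outer product supplies
this. -/
lemma exists_hermitian_mul_transpose_of_block (a u w b : ℂ) (ha : a.im = 0) (hb : b.im = 0)
    (h : (u ^ 2 + w ^ 2).im = 0) :
    ∃ H : Matrix (Fin 3) (Fin 3) ℂ, H.IsHermitian ∧ ∃ t : ℂ,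
      H * Hᵀ = !![a, 0, 0; 0, b + u, w; 0, w, b - u] + t • 1 := by
  have h' : (2 * u.re) * (-2 * u.im) = (2 * w.re) * (2 * w.im) := by
    simp [pow_two] at h
    linarith
  obtain ⟨x, y, z, v, h1, h2, h3, h4, h5⟩ :=
    exists_outer_product_of_det_eq_zero _ _ _ _ (4 * (b.re - a.re)) h'
  set T : ℝ := (x ^ 2 - y ^ 2 + z ^ 2 + v ^ 2) / 4 with hT
  have hr : √(a.re + T - b.re) ^ 2 = a.re + T - b.re := Real.sq_sqrt (by linarith)
  set r := √(a.re + T - b.re)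
  set β : ℂ := ⟨v / 2, -y / 2⟩ with hβ
  have hu : u = ⟨x * z / 2, -(y * v) / 2⟩ := by
    apply Complex.ext <;> simp <;> linarith
  have hw : w = ⟨x * v / 2, y * z / 2⟩ := by
    apply Complex.ext <;> simp <;> linarith
  have haa : a = (a.re : ℂ) := by apply Complex.ext <;> simp [ha]
  have hbb : b = (b.re : ℂ) := by apply Complex.ext <;> simp [hb]
  refine ⟨!![(r : ℂ), 0, 0; 0, ((x + z) / 2 : ℝ), β; 0, star β, ((x - z) / 2 : ℝ)], ?_,
    ((T - b.re : ℝ) : ℂ), ?_⟩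
  · ext i j
    fin_cases i <;> fin_cases j <;> simp
  · have hr' : r * r = a.re + T - b.re := by rw [← hr, pow_two]
    rw [haa, hbb, hu, hw]
    ext i j
    fin_cases i <;> fin_cases j <;>
      simp [Matrix.mul_apply, Fin.sum_univ_three, hβ, -Complex.ofReal_add,
        -Complex.ofReal_sub, -Complex.ofReal_div] <;>
      apply Complex.ext <;> simp <;> linarith

/-- Take H = P h Pᴴ. Since both Gram matrices are real, conjugating Pᵀ N P = N' gives Pᴴ N (Pᴴ)ᵀ =
N', so the problem may be solved in any basis whose Gram matrix is real. -/
lemma exists_hermitian_mul_of_congr {P S N : Matrix (Fin 3) (Fin 3) ℂ} {h s : Matrix (Fin 3) (Fin 3) ℂ}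
    {N' : Matrix (Fin 3) (Fin 3) ℂ} {t : ℂ}
    (hN : Pᵀ * N * P = N') (hNr : N.map star = N) (hN'r : N'.map star = N')
    (hh : h.IsHermitian) (hs : h * N' * hᵀ = s + t • N'⁻¹)
    (hS : S = P * s * Pᵀ) (hNi : N⁻¹ = P * N'⁻¹ * Pᵀ) :
    ∃ H : Matrix (Fin 3) (Fin 3) ℂ, H.IsHermitian ∧ ∃ t : ℂ, H * N * Hᵀ = S + t • N⁻¹ := by
  refine ⟨P * h * Pᴴ, ?_, t, ?_⟩
  · rw [Matrix.IsHermitian, conjTranspose_mul, conjTranspose_mul, conjTranspose_conjTranspose,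
      hh.eq, Matrix.mul_assoc]
  · have e : Pᴴ * N * (Pᴴ)ᵀ = N' := by
      have := congrArg (fun X : Matrix (Fin 3) (Fin 3) ℂ ↦ X.map (starRingEnd ℂ)) hN
      simp only [Matrix.map_mul] at this
      have h1 : N.map (starRingEnd ℂ) = N := hNr
      have h2 : N'.map (starRingEnd ℂ) = N' := hN'r
      rw [h1, h2] at this
      exact this
    rw [hS, hNi, transpose_mul, transpose_mul]
    calc P * h * Pᴴ * N * ((Pᴴ)ᵀ * (hᵀ * Pᵀ))
        = P * (h * (Pᴴ * N * (Pᴴ)ᵀ) * hᵀ) * Pᵀ := by simp only [Matrix.mul_assoc]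
      _ = _ := by
        rw [e, hs, Matrix.mul_add, Matrix.add_mul, Matrix.mul_smul, Matrix.smul_mul]

lemma exists_real_root_depressed_cubic (p q : ℝ) : ∃ x : ℝ, x ^ 3 + p * x + q = 0 := by
  have hc : Continuous fun x : ℝ ↦ x ^ 3 + p * x + q := by fun_prop
  -- At ±R the cubic term dominates the other two, so the signs at the endpoints are known.
  set R := 1 + |p| + |q|
  have hp := abs_nonneg p
  have hq := abs_nonneg q
  have h1 := neg_abs_le p
  have h2 := le_abs_self p
  have h3 := neg_abs_le q
  have h4 := le_abs_self q
  have hR : 1 ≤ R := by simp only [R]; linarith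
  have hR3 : |p| * R + |q| ≤ R ^ 3 := by
    have : (|p| + |q|) * R ≤ R ^ 3 := by
      have : R ^ 3 = R * R * R := by ring
      rw [this]
      have : |p| + |q| ≤ R * R := by nlinarith
      nlinarith
    nlinarith
  have ha : (-R) ^ 3 + p * (-R) + q ≤ 0 := by nlinarith
  have hb : 0 ≤ R ^ 3 + p * R + q := by nlinarith
  obtain ⟨x, -, hx⟩ := intermediate_value_Icc (by linarith : -R ≤ R) hc.continuousOn ⟨ha, hb⟩
  exact ⟨x, hx⟩

end SymmetricMatrices

/-! ### Solving H Hᵀ = S + t by eigenvector type -/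

section SymmetricMatrices

open Matrix

/-- The complex Householder reflection in u = v - e₀. It needs u to be non-null, and u·u = 2(1 -
v₀). -/
lemma exists_orthogonal_mulVec_single {v : Fin 3 → ℂ} (hv : v ⬝ᵥ v = 1) (h0 : v 0 ≠ 1) :
    ∃ P : Matrix (Fin 3) (Fin 3) ℂ, Pᵀ * P = 1 ∧ P *ᵥ Pi.single 0 1 = v := by
  have h1 : 1 - v 0 ≠ 0 := fun h ↦ h0 (by linear_combination -h)
  set u := v - Pi.single 0 1 with hu
  have huu : u ⬝ᵥ u = 2 * (1 - v 0) := by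
    simp [dotProduct, Fin.sum_univ_three, hu] at hv ⊢
    linear_combination hv
  refine ⟨1 - (1 - v 0)⁻¹ • vecMulVec u u, ?_, ?_⟩
  · rw [transpose_sub, transpose_smul, transpose_vecMulVec, transpose_one, Matrix.mul_sub,
      Matrix.sub_mul, Matrix.sub_mul, Matrix.one_mul, Matrix.one_mul, Matrix.mul_one,
      Matrix.smul_mul, Matrix.mul_smul, vecMulVec_mul_vecMulVec, huu]
    ext i j
    simp [vecMulVec_apply]
    field_simp
    ring
  · ext i
    fin_cases i <;>
      simp [hu, Matrix.mulVec, dotProduct, Fin.sum_univ_three, vecMulVec_apply] <;> field_simp <;>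
      ring

lemma exists_hermitian_of_nonnull_eigenvector {S : Matrix (Fin 3) (Fin 3) ℂ} (hS : Sᵀ = S)
    (htr : S.trace = 0) (htr2 : (S * S).trace.im = 0) {a : ℂ} (ha : a.im = 0) {v : Fin 3 → ℂ}
    (hv : v ⬝ᵥ v ≠ 0) (hSv : S *ᵥ v = a • v) :
    ∃ H : Matrix (Fin 3) (Fin 3) ℂ, H.IsHermitian ∧ ∃ t : ℂ, H * Hᵀ = S + t • 1 := by
  obtain ⟨v', hv', hSv', h0⟩ : ∃ v' : Fin 3 → ℂ, v' ⬝ᵥ v' = 1 ∧ S *ᵥ v' = a • v' ∧ v' 0 ≠ 1 := by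
    obtain ⟨z, hz⟩ : ∃ z : ℂ, v ⬝ᵥ v = z ^ 2 :=
      (IsAlgClosed.exists_pow_nat_eq (v ⬝ᵥ v) two_pos).imp fun z h ↦ h.symm
    have hz0 : z ≠ 0 := by
      rintro rfl
      exact hv (by simpa using hz)
    -- Either sign of the normalised eigenvector will do; at least one of them has first component
    -- different from 1.
    have key : ∀ k : ℂ, k ^ 2 = 1 → (((k * z⁻¹) • v) ⬝ᵥ ((k * z⁻¹) • v) = 1 ∧
        S *ᵥ ((k * z⁻¹) • v) = a • ((k * z⁻¹) • v)) := by
      intro k hk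
      constructor
      · simp only [smul_dotProduct, dotProduct_smul, hz, smul_eq_mul]
        field_simp
        exact hk
      · rw [mulVec_smul, hSv, smul_comm]
    by_cases h : (((1 : ℂ) * z⁻¹) • v) 0 = 1
    · refine ⟨_, (key (-1) (by norm_num)).1, (key (-1) (by norm_num)).2, ?_⟩
      have : (((-1 : ℂ) * z⁻¹) • v) 0 = -1 := by
        simp only [Pi.smul_apply, smul_eq_mul] at h ⊢
        linear_combination -h
      rw [this]
      norm_num
    · exact ⟨_, (key 1 (by norm_num)).1, (key 1 (by norm_num)).2, h⟩
  obtain ⟨P, hP, hPv⟩ := exists_orthogonal_mulVec_single hv' h0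
  have hP' : P * Pᵀ = 1 := mul_eq_one_comm.mp hP
  set S' := Pᵀ * S * P with hS'
  have hSS' : S = P * S' * Pᵀ := by
    calc S = (P * Pᵀ) * S * (P * Pᵀ) := by simp [hP']
      _ = _ := by simp only [hS', Matrix.mul_assoc]
  have hsymm : S'ᵀ = S' := by
    simp [hS', transpose_mul, hS, Matrix.mul_assoc]
  have hcol : S' *ᵥ Pi.single 0 1 = a • Pi.single 0 1 := by
    rw [hS', ← mulVec_mulVec, hPv, ← mulVec_mulVec, hSv', mulVec_smul, ← hPv, mulVec_mulVec, hP,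
      one_mulVec]
  have htr' : S'.trace = 0 := by
    rw [hS', Matrix.trace_mul_comm, ← Matrix.mul_assoc, hP', Matrix.one_mul, htr]
  have htr2' : (S' * S').trace = (S * S).trace := by
    have : S' * S' = Pᵀ * (S * S) * P := by
      calc S' * S' = Pᵀ * S * (P * Pᵀ) * S * P := by simp only [hS', Matrix.mul_assoc]
        _ = _ := by simp [hP', Matrix.mul_assoc]
    rw [this, Matrix.trace_mul_comm, ← Matrix.mul_assoc, hP', Matrix.one_mul]
  rw [← htr2'] at htr2
  have e0 := congrFun hcol 0
  have e1 := congrFun hcol 1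
  have e2 := congrFun hcol 2
  have s1 : S' 0 1 = S' 1 0 := congrFun (congrFun hsymm 1) 0
  have s2 : S' 0 2 = S' 2 0 := congrFun (congrFun hsymm 2) 0
  have s3 : S' 2 1 = S' 1 2 := congrFun (congrFun hsymm 1) 2
  simp at e0 e1 e2
  rw [trace_fin_three] at htr'
  -- As a is real, this identity carries reality of tr S² over to u² + w² for the 2×2 block.
  have hsq : (S' * S').trace
      = a ^ 2 + a ^ 2 / 2 + 2 * (((S' 1 1 - S' 2 2) / 2) ^ 2 + (S' 1 2) ^ 2) := by
    simp only [trace_fin_three, Matrix.mul_apply, Fin.sum_univ_three]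
    rw [s1, s2, s3, e0, e1, e2]
    linear_combination (1 / 2) * (S' 1 1 + S' 2 2 - a) * htr' -
      (1 / 2) * (S' 1 1 + S' 2 2 - a) * e0
  have hb : (-a / 2).im = 0 := by simp [ha]
  have huw : (((S' 1 1 - S' 2 2) / 2) ^ 2 + (S' 1 2) ^ 2).im = 0 := by
    rw [hsq] at htr2
    obtain ⟨r, rfl⟩ : ∃ r : ℝ, a = r := ⟨a.re, by apply Complex.ext <;> simp [ha]⟩
    have : ((r : ℂ) ^ 2 + (r : ℂ) ^ 2 / 2).im = 0 := by norm_cast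
    rw [Complex.add_im, this, Complex.mul_im] at htr2
    simpa using htr2
  obtain ⟨h, hh, t, ht⟩ := exists_hermitian_mul_transpose_of_block a _ _ _ ha hb huw
  have hS'' : !![a, 0, 0; 0, -a / 2 + (S' 1 1 - S' 2 2) / 2, S' 1 2;
      0, S' 1 2, -a / 2 - (S' 1 1 - S' 2 2) / 2] = S' := by
    ext i j
    fin_cases i <;> fin_cases j <;> simp [e0, e1, e2, s1, s2, s3] <;>
      linear_combination (1 / 2) * e0 - (1 / 2) * htr'
  rw [hS''] at ht
  obtain ⟨H, hH, t, ht⟩ := exists_hermitian_mul_of_congr (P := P) (S := S) (N := 1) (N' := 1)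
    (h := h) (s := S') (t := t) (by simpa using hP) (by ext i j; simp [Matrix.one_apply, apply_ite])
    (by ext i j; simp [Matrix.one_apply, apply_ite]) hh (by simpa using ht) hSS' (by simp [hP'])
  exact ⟨H, hH, t, by simpa using ht⟩

/-- Newton's identities: for vanishing trace the other coefficients of the characteristic polynomial
are -tr S²/2 and -tr S³/3. -/
lemma det_sub_smul_one_of_trace_eq_zero {S : Matrix (Fin 3) (Fin 3) ℂ} (htr : S.trace = 0) (x : ℂ) :
    (S - x • 1).det = -(x ^ 3 - (S * S).trace / 2 * x - (S * S * S).trace / 3) := by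
  have h : S 2 2 = -S 0 0 - S 1 1 := by
    rw [trace_fin_three] at htr
    linear_combination htr
  simp [det_fin_three, trace_fin_three, Matrix.mul_apply, Fin.sum_univ_three, h]
  ring

/-- The conjugate of v is again null and pairs with v to a nonzero number, so it normalises to n. By
Lagrange's identity (v × n)² = -1, whence m = i v × n is a unit vector orthogonal to both. -/
lemma exists_null_frame {v : Fin 3 → ℂ} (hv0 : v ≠ 0) (hv : v ⬝ᵥ v = 0) :
    ∃ m n : Fin 3 → ℂ, m ⬝ᵥ m = 1 ∧ n ⬝ᵥ n = 0 ∧ v ⬝ᵥ m = 0 ∧ v ⬝ᵥ n = 1 ∧ m ⬝ᵥ n = 0 := by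
  set c := v ⬝ᵥ star v with hc
  have hc0 : c ≠ 0 := by
    intro h
    apply hv0
    have h' : ((∑ i, ‖v i‖ ^ 2 : ℝ) : ℂ) = 0 := by
      rw [← h, hc]
      simp [dotProduct, Complex.mul_conj']
    rw [Complex.ofReal_eq_zero, Finset.sum_eq_zero_iff_of_nonneg (fun i _ ↦ by positivity)] at h'
    ext i
    simpa using h' i (Finset.mem_univ i)
  have hvv : star v ⬝ᵥ star v = 0 := by
    rw [Matrix.star_dotProduct_star, hv, star_zero]
  set n := c⁻¹ • star v with hn
  have hnn : n ⬝ᵥ n = 0 := by simp [hn, hvv]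
  have hvn : v ⬝ᵥ n = 1 := by simp [hn, ← hc, hc0]
  refine ⟨Complex.I • (crossProduct v n), n, ?_, hnn, ?_, hvn, ?_⟩
  · rw [smul_dotProduct, dotProduct_smul, cross_dot_cross, hv, hnn, hvn, dotProduct_comm n v, hvn]
    simp
  · rw [dotProduct_smul, dot_self_cross, smul_zero]
  · rw [smul_dotProduct, dotProduct_comm, dot_cross_self, smul_zero]


/-- The antidiagonal Gram matrix of a null frame. -/
def nullGram : Matrix (Fin 3) (Fin 3) ℂ := !![0, 0, 1; 0, 1, 0; 1, 0, 0]

lemma nullGram_mul_self : nullGram * nullGram = 1 := by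
  ext i j
  fin_cases i <;> fin_cases j <;> simp [nullGram, Matrix.mul_apply, Fin.sum_univ_three]

lemma nullGram_inv : nullGram⁻¹ = nullGram := inv_eq_right_inv nullGram_mul_self

/-- Writing k = κ|k| with |κ| = 1, the phase of k is absorbed into the corner entry κ². The real
unknowns q and α then match the imaginary and real parts of c/κ². -/
lemma exists_hermitian_of_nilpotent (c k : ℂ) (hk : k ≠ 0) :
    ∃ h : Matrix (Fin 3) (Fin 3) ℂ, h.IsHermitian ∧
      h * nullGram * hᵀ = !![c, k, 0; k, 0, 0; 0, 0, 0] + (1 : ℂ) • nullGram := by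
  have hr : (‖k‖ : ℂ) ≠ 0 := by simpa using hk
  set r : ℝ := ‖k‖ with hrdef
  set κ : ℂ := k / r with hκ
  have hkκ : k = κ * r := by rw [hκ]; field_simp
  have hκκ : κ * star κ = 1 := by
    have : k * star k = (r : ℂ) ^ 2 := by
      rw [hrdef]; exact Complex.mul_conj' k
    rw [hκ, star_div₀]
    simp only [Complex.star_def, Complex.conj_ofReal] at this ⊢
    field_simp
    exact this
  have hκ0 : κ ≠ 0 := left_ne_zero_of_mul_eq_one hκκ
  set d : ℂ := c / κ ^ 2 with hd
  have hcd : c = κ ^ 2 * (d.re + d.im * Complex.I) := by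
    rw [Complex.re_add_im, hd]; field_simp
  set q : ℝ := d.im / r with hq
  have hqr : (d.im : ℂ) = q * r := by
    rw [hq]; push_cast; field_simp
  set α : ℝ := (d.re - r ^ 2 / 4 + q ^ 2) / 2 with hα
  have hα' : (d.re : ℂ) = 2 * α + r ^ 2 / 4 - q ^ 2 := by
    rw [hα]; push_cast; ring
  set β : ℂ := κ * (r / 2 + q * Complex.I) with hβ
  have hβs : star β = star κ * (r / 2 - q * Complex.I) := by
    simp [hβ, Complex.conj_ofReal]
    ring_nf
    simp
  have hI := Complex.I_sq
  refine ⟨!![(α : ℂ), β, κ ^ 2; star β, 1, 0; star (κ ^ 2), 0, 0], ?_, ?_⟩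
  · ext i j
    fin_cases i <;> fin_cases j <;> simp
  · rw [hcd, hqr, hα', hkκ, hβs, hβ, star_pow]
    have hκ2 : κ ^ 2 * star κ ^ 2 = 1 := by rw [← mul_pow, hκκ, one_pow]
    generalize star κ = κ' at *
    ext i j
    fin_cases i <;> fin_cases j <;>
      simp [nullGram, Matrix.mul_apply, Fin.sum_univ_three]
    · linear_combination κ ^ 2 * q ^ 2 * hI
    · linear_combination κ * (r / 2 - q * Complex.I) * hκκ
    · linear_combination hκ2
    · linear_combination κ * (r / 2 - q * Complex.I) * hκκ
    · linear_combination hκ2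

lemma exists_hermitian_mul_transpose_of_real_invariants {S : Matrix (Fin 3) (Fin 3) ℂ} (hS : Sᵀ = S)
    (htr : S.trace = 0) (htr2 : (S * S).trace.im = 0) (htr3 : (S * S * S).trace.im = 0) :
    ∃ H : Matrix (Fin 3) (Fin 3) ℂ, H.IsHermitian ∧ ∃ t : ℂ, H * Hᵀ = S + t • 1 := by
  -- Real tr S² and tr S³ make the characteristic polynomial a real cubic, so some eigenvalue is
  -- real.
  obtain ⟨x, hx⟩ := exists_real_root_depressed_cubic (-((S * S).trace.re / 2))
    (-((S * S * S).trace.re / 3))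
  have h2 : (S * S).trace = ((S * S).trace.re : ℂ) := by
    apply Complex.ext <;> simp [htr2]
  have h3 : (S * S * S).trace = ((S * S * S).trace.re : ℂ) := by
    apply Complex.ext <;> simp [htr3]
  have hdet : (S - (x : ℂ) • 1).det = 0 := by
    rw [det_sub_smul_one_of_trace_eq_zero htr, h2, h3, neg_eq_zero]
    have : ((x ^ 3 + -((S * S).trace.re / 2) * x + -((S * S * S).trace.re / 3) : ℝ) : ℂ) = 0 := by
      rw [hx]; simp
    push_cast at this
    linear_combination this
  obtain ⟨v, hv0, hv⟩ := exists_mulVec_eq_zero_iff.mpr hdet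
  have hSv : S *ᵥ v = (x : ℂ) • v := by
    rw [sub_mulVec, smul_mulVec, one_mulVec, sub_eq_zero] at hv
    exact hv
  by_cases hvv : v ⬝ᵥ v = 0
  swap
  · exact exists_hermitian_of_nonnull_eigenvector hS htr htr2 (by simp) hvv hSv
  obtain ⟨m, n, hmm, hnn, hvm, hvn, hmn⟩ := exists_null_frame hv0 hvv
  set P : Matrix (Fin 3) (Fin 3) ℂ := (of ![v, m, n])ᵀ with hP
  have hPP : Pᵀ * P = nullGram := by
    ext i j
    have hij : (Pᵀ * P) i j = ![v, m, n] i ⬝ᵥ ![v, m, n] j := rfl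
    rw [hij]
    fin_cases i <;> fin_cases j <;>
      simp [nullGram, hmm, hnn, hvm, hvn, hmn, hvv, dotProduct_comm m v, dotProduct_comm n v,
        dotProduct_comm n m]
  have hinv : nullGram * Pᵀ * P = 1 := by
    rw [Matrix.mul_assoc, hPP, nullGram_mul_self]
  have hinv' : P * (nullGram * Pᵀ) = 1 := mul_eq_one_comm.mp hinv
  have hinv'' : P * nullGram * Pᵀ = 1 := by rw [Matrix.mul_assoc, hinv']
  set s := Pᵀ * S * P with hs
  have hSs : S = P * (nullGram * s * nullGram) * Pᵀ := by
    calc S = (P * nullGram * Pᵀ) * S * (P * nullGram * Pᵀ) := by simp [hinv'']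
      _ = _ := by simp only [hs, Matrix.mul_assoc]
  have hSP : S * P = P * (nullGram * s) := by
    calc S * P = (P * nullGram * Pᵀ) * S * P := by simp [hinv'']
      _ = _ := by simp only [hs, Matrix.mul_assoc]
  have hsT : sᵀ = s := by
    simp [hs, transpose_mul, hS, Matrix.mul_assoc]
  have hPv : P *ᵥ Pi.single 0 1 = v := by
    ext i
    simp [hP]
  have hcol : s *ᵥ Pi.single 0 1 = (x : ℂ) • nullGram *ᵥ Pi.single 0 1 := by
    rw [hs, ← mulVec_mulVec, hPv, ← mulVec_mulVec, hSv, mulVec_smul, ← hPv, mulVec_mulVec, hPP]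
  have htrs : (s * nullGram).trace = 0 := by
    calc (s * nullGram).trace = (Pᵀ * (S * P * nullGram)).trace := by
          simp only [hs, Matrix.mul_assoc]
      _ = (S * (P * nullGram * Pᵀ)).trace := by
          rw [Matrix.trace_mul_comm]; simp only [Matrix.mul_assoc]
      _ = 0 := by rw [hinv'', Matrix.mul_one, htr]
  have s00 : s 0 0 = 0 := by simpa [nullGram] using congrFun hcol 0
  have s10 : s 1 0 = 0 := by simpa [nullGram] using congrFun hcol 1
  have s20 : s 2 0 = x := by simpa [nullGram] using congrFun hcol 2
  have s01 : s 0 1 = 0 := by rw [← hsT, transpose_apply, s10]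
  have s02 : s 0 2 = x := by rw [← hsT, transpose_apply, s20]
  have s21 : s 2 1 = s 1 2 := by rw [← hsT, transpose_apply, hsT]
  have s11 : s 1 1 = -2 * x := by
    simp [trace_fin_three, nullGram, Matrix.mul_apply, Fin.sum_univ_three, s20, s02] at htrs
    linear_combination htrs
  have hs_eq : s = !![0, 0, (x : ℂ); 0, -2 * x, s 1 2; (x : ℂ), s 1 2, s 2 2] := by
    ext i j
    fin_cases i <;> fin_cases j <;> simp [s00, s10, s20, s01, s02, s21, s11]
  -- The vector m + ξv has square 1, and it is an eigenvector for the real eigenvalue -2x exactly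
  -- when 3xξ = -s₁₂.
  by_cases hξ : ∃ ξ : ℂ, 3 * x * ξ = -s 1 2
  · obtain ⟨ξ, hξ⟩ := hξ
    refine exists_hermitian_of_nonnull_eigenvector hS htr htr2 (a := -2 * x) (by simp)
      (v := P *ᵥ ![ξ, 1, 0]) ?_ ?_
    · rw [dotProduct_mulVec, ← mulVec_transpose, mulVec_mulVec, hPP]
      simp [nullGram, dotProduct, Fin.sum_univ_three]
    · rw [mulVec_mulVec, hSP, ← mulVec_mulVec, ← mulVec_smul]
      congr 1
      rw [hs_eq]
      ext i
      fin_cases i <;> simp [nullGram, mulVec, dotProduct, Fin.sum_univ_three, Matrix.mul_apply]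
      linear_combination hξ
  -- Unsolvability forces x = 0 and s₁₂ ≠ 0: S is then one nilpotent Jordan block, and the null
  -- frame, whose Gram matrix is real, is kept as the basis.
  · have hx0 : (x : ℂ) = 0 := by
      by_contra hx0
      exact hξ ⟨-s 1 2 / (3 * x), by field_simp⟩
    have hk : s 1 2 ≠ 0 := fun hk ↦ hξ ⟨0, by simp [hk]⟩
    obtain ⟨h, hh, ht⟩ := exists_hermitian_of_nilpotent (s 2 2) (s 1 2) hk
    have hNr : nullGram.map star = nullGram := by
      ext i j
      fin_cases i <;> fin_cases j <;> simp [nullGram]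
    obtain ⟨H, hH, t, ht⟩ := exists_hermitian_mul_of_congr (P := P) (S := S) (N := 1)
      (N' := nullGram) (h := h) (s := !![s 2 2, s 1 2, 0; s 1 2, 0, 0; 0, 0, 0]) (t := 1)
      (by simpa using hPP)
      (by ext i j; simp [Matrix.one_apply, apply_ite]) hNr hh (by rw [nullGram_inv, ht])
      (by
        have : nullGram * s * nullGram = !![s 2 2, s 1 2, 0; s 1 2, 0, 0; 0, 0, 0] := by
          rw [hs_eq, hx0]
          ext i j
          fin_cases i <;> fin_cases j <;>
            simp [nullGram, Matrix.mul_apply, Fin.sum_univ_three]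
        rw [← this, ← hSs])
      (by rw [nullGram_inv, inv_one, hinv''])
    exact ⟨H, hH, t, by simpa using ht⟩

end SymmetricMatrices

/-! ### Spinors with two symmetric index pairs as 3×3 matrices -/

section SpinorMatrices

open Matrix

/-- The Gram matrix of the form `φ_{AB} φ^{AB}` on symmetric spinors, in the components
`(00, 01, 11)`. -/
def symGram : Matrix (Fin 3) (Fin 3) ℂ := !![0, 0, 1; 0, -2, 0; 1, 0, 0]

lemma symGram_inv : symGram⁻¹ = !![0, 0, 1; 0, -(1 / 2), 0; 1, 0, 0] := by
  refine inv_eq_right_inv ?_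
  ext i j
  fin_cases i <;> fin_cases j <;> simp [symGram, Matrix.mul_apply, Fin.sum_univ_three]

lemma symGram_mul_inv : symGram * symGram⁻¹ = 1 := by
  rw [symGram_inv]
  ext i j
  fin_cases i <;> fin_cases j <;> simp [symGram, Matrix.mul_apply, Fin.sum_univ_three]

lemma symGram_inv_mul : symGram⁻¹ * symGram = 1 := mul_eq_one_comm.mp symGram_mul_inv

lemma symGram_transpose : symGramᵀ = symGram := by
  ext i j
  fin_cases i <;> fin_cases j <;> simp [symGram]

lemma symGram_map_star : symGram.map star = symGram := by
  ext i j
  fin_cases i <;> fin_cases j <;> simp [symGram, Complex.conj_ofNat]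

lemma exists_symGram_orthonormal_basis :
    ∃ Q : Matrix (Fin 3) (Fin 3) ℂ, Qᵀ * symGram * Q = 1 := by
  have hr : ((√2 : ℝ) : ℂ)⁻¹ * ((√2 : ℝ) : ℂ)⁻¹ = 1 / 2 := by
    rw [← mul_inv, ← Complex.ofReal_mul, Real.mul_self_sqrt (by norm_num)]
    norm_num
  set s := ((√2 : ℝ) : ℂ)⁻¹
  have hI := Complex.I_mul_I
  refine ⟨!![s, s * Complex.I, 0; 0, 0, s * Complex.I; s, -(s * Complex.I), 0], ?_⟩
  ext i j
  fin_cases i <;> fin_cases j <;>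
    simp [symGram, Matrix.mul_apply, Fin.sum_univ_three]
  · linear_combination 2 * hr
  · linear_combination -2 * Complex.I ^ 2 * hr - hI
  · linear_combination -2 * Complex.I ^ 2 * hr - hI

/-- In an N-orthonormal basis Q the matrix S = Qᵀ N Ψ N Q is symmetric and similar to ΨN, so the
hypotheses on traces pass to S; the solution comes back by congruence. -/
lemma exists_hermitian_mul_symGram_of_real_invariants {Ψ : Matrix (Fin 3) (Fin 3) ℂ} (hΨ : Ψᵀ = Ψ)
    (htr : (Ψ * symGram).trace = 0) (htr2 : (Ψ * symGram * (Ψ * symGram)).trace.im = 0)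
    (htr3 : (Ψ * symGram * (Ψ * symGram) * (Ψ * symGram)).trace.im = 0) :
    ∃ H : Matrix (Fin 3) (Fin 3) ℂ, H.IsHermitian ∧
      ∃ t : ℂ, H * symGram * Hᵀ = Ψ + t • symGram⁻¹ := by
  obtain ⟨Q, hQ⟩ := exists_symGram_orthonormal_basis
  have hQ' : Q * (Qᵀ * symGram) = 1 := mul_eq_one_comm.mp hQ
  have hQQ : Q * Qᵀ = symGram⁻¹ := by
    rw [← Matrix.mul_one (Q * Qᵀ), ← symGram_mul_inv, ← Matrix.mul_assoc, Matrix.mul_assoc Q, hQ',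
      Matrix.one_mul]
  set S := Qᵀ * symGram * Ψ * symGram * Q with hS
  have hSQ : S = Qᵀ * symGram * (Ψ * symGram * Q) := by simp only [hS, Matrix.mul_assoc]
  have hQS : Ψ * symGram * Q = Q * S := by
    rw [hSQ, ← Matrix.mul_assoc Q, hQ', Matrix.one_mul]
  have hconj : ∀ X : Matrix (Fin 3) (Fin 3) ℂ, (Qᵀ * symGram * (X * Q)).trace = X.trace := by
    intro X
    rw [Matrix.trace_mul_comm, Matrix.mul_assoc, hQ', Matrix.mul_one]
  have h2 : S * S = Qᵀ * symGram * (Ψ * symGram * (Ψ * symGram) * Q) := by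
    rw [hSQ, Matrix.mul_assoc (Qᵀ * symGram), ← hSQ, Matrix.mul_assoc (Ψ * symGram),
      Matrix.mul_assoc (Ψ * symGram), hQS, Matrix.mul_assoc]
  have h3 : S * S * S
      = Qᵀ * symGram * (Ψ * symGram * (Ψ * symGram) * (Ψ * symGram) * Q) := by
    rw [h2, Matrix.mul_assoc (Qᵀ * symGram), Matrix.mul_assoc _ Q S, ← hQS]
    simp only [Matrix.mul_assoc]
  obtain ⟨h, hh, t, ht⟩ := exists_hermitian_mul_transpose_of_real_invariants (S := S)
    (by simp only [hS, transpose_mul, hΨ, symGram_transpose, transpose_transpose,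
      Matrix.mul_assoc]) (by rw [hSQ, hconj, htr]) (by rw [h2, hconj, htr2])
    (by rw [h3, hconj, htr3])
  refine exists_hermitian_mul_of_congr (P := Q) (N' := 1) (h := h) (s := S) (t := t) hQ
    symGram_map_star (by ext i j; simp [Matrix.one_apply, apply_ite]) hh (by simpa using ht) ?_
    (by simp [hQQ])
  rw [← hQS, Matrix.mul_assoc _ Q, hQQ, Matrix.mul_assoc, symGram_mul_inv, Matrix.mul_one]

lemma trace_mul_pow_comm {n R : Type*} [Fintype n] [DecidableEq n] [CommRing R] (A B : Matrix n n R)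
    (k : ℕ) : ((A * B) ^ k).trace = ((B * A) ^ k).trace := by
  have h : ∀ k, (A * B) ^ (k + 1) = A * ((B * A) ^ k * B) := by
    intro k
    induction k with
    | zero => simp
    | succ k ih => rw [pow_succ, ih, pow_succ]; simp only [Matrix.mul_assoc]
  cases k with
  | zero => simp
  | succ k => rw [h, Matrix.trace_mul_comm, Matrix.mul_assoc, pow_succ]

/-- Entrywise conjugation exchanges h and hᵀ, hence sends AB to BA for A = hN and B = hᵀN, and the
powers of AB and BA have equal traces. -/
lemma trace_im_eq_zero_of_hermitian {h : Matrix (Fin 3) (Fin 3) ℂ} (hh : h.IsHermitian) (k : ℕ) :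
    ((h * symGram * hᵀ * symGram) ^ k).trace.im = 0 := by
  have h2 : (hᵀ).map (starRingEnd ℂ) = h := hh.eq
  have h1 : h.map (starRingEnd ℂ) = hᵀ := by
    conv_rhs => rw [← h2]
    ext i j
    simp
  have h3 : symGram.map (starRingEnd ℂ) = symGram := symGram_map_star
  have hY : (starRingEnd ℂ).mapMatrix (h * symGram * hᵀ * symGram)
      = hᵀ * symGram * (h * symGram) := by
    simp only [RingHom.mapMatrix_apply, Matrix.map_mul, h1, h2, h3, Matrix.mul_assoc]
  have : starRingEnd ℂ ((h * symGram * hᵀ * symGram) ^ k).trace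
      = ((h * symGram * hᵀ * symGram) ^ k).trace := by
    have htr : ∀ M : Matrix (Fin 3) (Fin 3) ℂ,
        starRingEnd ℂ M.trace = ((starRingEnd ℂ).mapMatrix M).trace := by
      intro M
      simp [trace_fin_three]
    rw [htr, map_pow, hY, trace_mul_pow_comm]
    simp only [Matrix.mul_assoc]
  exact Complex.conj_eq_iff_im.mp this

/-- The position of `AB` among the components `(00, 01, 11)` of a symmetric spinor. -/
def pairIndex : Fin 2 → Fin 2 → Fin 3 := ![![0, 1], ![1, 2]]

/-- The spinor `X_{(AB)(CD)}` with given components `(00, 01, 11)` in both pairs. -/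
def pairSpinor (X : Matrix (Fin 3) (Fin 3) ℂ) : Spinor4 := fun A B C D ↦
  X (pairIndex A B) (pairIndex C D)

lemma invI_pairSpinor (X : Matrix (Fin 3) (Fin 3) ℂ) (hX : Xᵀ = X) :
    invI (pairSpinor X) = (X * symGram * (X * symGram)).trace := by
  have h1 : X 1 0 = X 0 1 := congrFun (congrFun hX 0) 1
  have h2 : X 2 0 = X 0 2 := congrFun (congrFun hX 0) 2
  have h3 : X 2 1 = X 1 2 := congrFun (congrFun hX 1) 2
  simp [invI, raiseAll, pairSpinor, pairIndex, eps, Fin.sum_univ_two, trace_fin_three,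
    Matrix.mul_apply, Fin.sum_univ_three, symGram, h1, h2, h3]
  ring

lemma raiseLast_pairSpinor (X : Matrix (Fin 3) (Fin 3) ℂ) (A B C D : Fin 2) :
    raiseLast (pairSpinor X) A B C D
      = (X * (!![0, 0, 1; 0, -1, 0; 1, 0, 0] : Matrix (Fin 3) (Fin 3) ℂ)) (pairIndex A B) (pairIndex C D) := by
  generalize hX : pairIndex A B = i
  simp only [raiseLast, pairSpinor, hX]
  fin_cases C <;> fin_cases D <;>
  simp [eps, Fin.sum_univ_two, pairIndex, Matrix.mul_apply, Fin.sum_univ_three]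

lemma invJ_pairSpinor (X : Matrix (Fin 3) (Fin 3) ℂ) :
    invJ (pairSpinor X) = (X * symGram * (X * symGram) * (X * symGram)).trace := by
  set Y := X * (!![0, 0, 1; 0, -1, 0; 1, 0, 0] : Matrix (Fin 3) (Fin 3) ℂ) with hY
  -- The index pairs 01 and 10 both occur in a contraction, so the middle component counts twice.
  have hN : X * symGram = Y * diagonal ![1, 2, 1] := by
    rw [hY, Matrix.mul_assoc]
    congr 1
    ext i j
    fin_cases i <;> fin_cases j <;> simp [symGram]
  rw [hN]
  simp only [invJ, raiseLast_pairSpinor, ← hY]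
  clear_value Y
  simp [Fin.sum_univ_two, pairIndex, trace_fin_three, Matrix.mul_apply, Fin.sum_univ_three,
    diagonal_apply]
  ring

/-- Makes the symmetriser a finite sum over quadruples of distinct indices, which simplification can
expand. -/
lemma sum_perm_fin_four {R : Type*} [AddCommMonoid R] (f : Fin 4 → Fin 4 → Fin 4 → Fin 4 → R) :
    ∑ π : Equiv.Perm (Fin 4), f (π 0) (π 1) (π 2) (π 3) =
      ∑ a, ∑ b, ∑ c, ∑ d, if [a, b, c, d].Nodup then f a b c d else 0 := by
  have hinj : Function.Injective fun π : Equiv.Perm (Fin 4) ↦ (π 0, π 1, π 2, π 3) := by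
    intro π ρ h
    simp only [Prod.mk.injEq] at h
    ext i
    fin_cases i <;> simp [h]
  have himg : (Finset.univ.map ⟨_, hinj⟩ : Finset (Fin 4 × Fin 4 × Fin 4 × Fin 4))
      = Finset.univ.filter fun t ↦ [t.1, t.2.1, t.2.2.1, t.2.2.2].Nodup := by
    decide +revert +kernel
  have := Finset.sum_map Finset.univ ⟨_, hinj⟩
    fun t : Fin 4 × Fin 4 × Fin 4 × Fin 4 ↦ f t.1 t.2.1 t.2.2.1 t.2.2.2
  simp only [Function.Embedding.coeFn_mk] at this
  rw [← this, himg, Finset.sum_filter]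
  simp only [Fintype.sum_prod_type]

lemma pairIndex_comm (A B : Fin 2) : pairIndex A B = pairIndex B A := by
  fin_cases A <;> fin_cases B <;> rfl

/-- With the symmetries within and between the pairs, the 24 permutations fall into three classes of
eight, one for each way of splitting A, B, C, D into pairs. -/
lemma symmetrize_pairSpinor {K : Matrix (Fin 3) (Fin 3) ℂ} (hK : Kᵀ = K) (A B C D : Fin 2) :
    symmetrize (pairSpinor K) A B C D = (1 / 3) *
      (pairSpinor K A B C D + pairSpinor K A C B D + pairSpinor K A D B C) := by
  have h1 : ∀ i j, K i j = K j i := fun i j ↦ congrFun (congrFun hK j) i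
  rw [symmetrize, sum_perm_fin_four (fun a b c d ↦ pairSpinor K (![A, B, C, D] a)
    (![A, B, C, D] b) (![A, B, C, D] c) (![A, B, C, D] d))]
  simp [Fin.sum_univ_four, pairSpinor, pairIndex_comm B A, pairIndex_comm C A, pairIndex_comm D A,
    pairIndex_comm C B, pairIndex_comm D B, pairIndex_comm D C, h1 (pairIndex C D),
    h1 (pairIndex B D), h1 (pairIndex B C)]
  ring

lemma spinorSquare_pairSpinor (h : Matrix (Fin 3) (Fin 3) ℂ) :
    spinorSquare (pairSpinor h) = pairSpinor (h * symGram * hᵀ) := by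
  funext A B C D
  simp only [spinorSquare, pairSpinor]
  generalize pairIndex A B = i
  generalize pairIndex C D = j
  simp [eps, Fin.sum_univ_two, pairIndex, Matrix.mul_apply, Fin.sum_univ_three, symGram]
  ring

/-- A symmetric matrix K represents a totally symmetric spinor iff K₀₂ = K₁₁. The complement of
these is the line of N⁻¹, so symmetrising is a correction along N⁻¹. -/
lemma symmetrize_spinorSquare (h : Matrix (Fin 3) (Fin 3) ℂ) :
    symmetrize (spinorSquare (pairSpinor h)) =
      pairSpinor (h * symGram * hᵀ + ((2 / 3) * ((h * symGram * hᵀ) 1 1 - (h * symGram * hᵀ) 0 2))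
        • symGram⁻¹) := by
  have hK : (h * symGram * hᵀ)ᵀ = h * symGram * hᵀ := by
    simp only [transpose_mul, transpose_transpose, symGram_transpose, Matrix.mul_assoc]
  rw [spinorSquare_pairSpinor]
  generalize h * symGram * hᵀ = K at *
  have h1 : ∀ i j, K i j = K j i := fun i j ↦ congrFun (congrFun hK j) i
  funext A B C D
  rw [symmetrize_pairSpinor hK, symGram_inv]
  fin_cases A <;> fin_cases B <;> fin_cases C <;> fin_cases D <;>
    simp [pairSpinor, pairIndex, h1 1 0, h1 2 0, h1 2 1] <;> ring

end SpinorMatrices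

/-! ### Reality of the invariants and solvability in components -/

section SpinorMatrices

open Matrix

/-- Here XN = cY + t with all power traces of Y real; since tr XN = 0, also t is real, and the
traces of (XN)² and (XN)³ expand into real terms. -/
lemma im_invariants_eq_zero_of_hermitian {H : Matrix (Fin 3) (Fin 3) ℂ} (hH : H.IsHermitian)
    (c : ℝ) (t : ℂ) {X : Matrix (Fin 3) (Fin 3) ℂ}
    (hX : X = (c : ℂ) • (H * symGram * Hᵀ) + t • symGram⁻¹) (htr : X 0 2 = X 1 1) :
    (invI (pairSpinor X)).im = 0 ∧ (invJ (pairSpinor X)).im = 0 := by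
  have hXT : Xᵀ = X := by
    rw [hX, transpose_add, transpose_smul, transpose_smul, transpose_nonsing_inv, symGram_transpose]
    simp only [transpose_mul, transpose_transpose, symGram_transpose, Matrix.mul_assoc]
  rw [invI_pairSpinor X hXT, invJ_pairSpinor]
  set Y := H * symGram * Hᵀ * symGram with hY
  have hXY : X * symGram = (c : ℂ) • Y + t • 1 := by
    rw [hX, Matrix.add_mul, Matrix.smul_mul, Matrix.smul_mul, symGram_inv_mul]
  have h0 : (X * symGram).trace = 0 := by
    have h2 : X 2 0 = X 0 2 := congrFun (congrFun hXT 0) 2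
    simp [trace_fin_three, Matrix.mul_apply, Fin.sum_univ_three, symGram, htr, h2]
    ring
  obtain ⟨y1, hy1⟩ : ∃ y : ℝ, Y.trace = y := by
    have := trace_im_eq_zero_of_hermitian hH 1
    exact ⟨_, Complex.ext rfl (by simpa using this)⟩
  obtain ⟨y2, hy2⟩ : ∃ y : ℝ, (Y * Y).trace = y := by
    have := trace_im_eq_zero_of_hermitian hH 2
    exact ⟨_, Complex.ext rfl (by simpa [pow_two] using this)⟩
  obtain ⟨y3, hy3⟩ : ∃ y : ℝ, (Y * Y * Y).trace = y := by
    have := trace_im_eq_zero_of_hermitian hH 3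
    exact ⟨_, Complex.ext rfl (by simpa [pow_succ] using this)⟩
  obtain ⟨t, rfl⟩ : ∃ s : ℝ, t = s := by
    refine ⟨-(c * y1) / 3, ?_⟩
    rw [hXY, trace_add, trace_smul, trace_smul, hy1, trace_one] at h0
    simp at h0
    push_cast
    linear_combination h0 / 3
  have e2 : (X * symGram * (X * symGram)).trace
      = ((c ^ 2 * y2 + 2 * c * t * y1 + 3 * t ^ 2 : ℝ) : ℂ) := by
    rw [hXY]
    simp only [Matrix.add_mul, Matrix.mul_add, Matrix.smul_mul, Matrix.mul_smul, Matrix.mul_one,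
      Matrix.one_mul, trace_add, trace_smul, hy1, hy2, trace_one]
    simp
    ring
  have e3 : (X * symGram * (X * symGram) * (X * symGram)).trace
      = ((c ^ 3 * y3 + 3 * c ^ 2 * t * y2 + 3 * c * t ^ 2 * y1 + 3 * t ^ 3 : ℝ) : ℂ) := by
    rw [hXY]
    simp only [Matrix.add_mul, Matrix.mul_add, Matrix.smul_mul, Matrix.mul_smul, Matrix.mul_one,
      Matrix.one_mul, trace_add, trace_smul, hy1, hy2, hy3, trace_one]
    simp
    ring
  rw [e2, e3]
  exact ⟨Complex.ofReal_im _, Complex.ofReal_im _⟩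

/-- The Hermitian matrix of spinor components `s_{(AB)(A'B')}` of a symmetric tensor; it only
depends on the trace-free part of the tensor. -/
def hermitianOfTensor (T : Fin 4 → Fin 4 → ℝ) : Matrix (Fin 3) (Fin 3) ℂ :=
  !![⟨(T 0 0 + 2 * T 0 3 + T 3 3) / 2, 0⟩, ⟨(T 0 1 + T 1 3) / 2, -(T 0 2 + T 2 3) / 2⟩,
      ⟨(T 1 1 - T 2 2) / 2, -T 1 2⟩;
    ⟨(T 0 1 + T 1 3) / 2, (T 0 2 + T 2 3) / 2⟩, ⟨(T 0 0 + T 1 1 + T 2 2 - T 3 3) / 4, 0⟩,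
      ⟨(T 0 1 - T 1 3) / 2, -(T 0 2 - T 2 3) / 2⟩;
    ⟨(T 1 1 - T 2 2) / 2, T 1 2⟩, ⟨(T 0 1 - T 1 3) / 2, (T 0 2 - T 2 3) / 2⟩,
      ⟨(T 0 0 - 2 * T 0 3 + T 3 3) / 2, 0⟩]

lemma isHermitian_hermitianOfTensor (T : Fin 4 → Fin 4 → ℝ) : (hermitianOfTensor T).IsHermitian := by
  ext i j
  fin_cases i <;> fin_cases j <;> apply Complex.ext <;> simp [hermitianOfTensor]
  all_goals ring

/-- The Pauli matrices, which are the Infeld–van der Waerden symbols up to normalisation. -/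
def pauli : Fin 4 → Matrix (Fin 2) (Fin 2) ℂ :=
  ![!![1, 0; 0, 1], !![0, 1; 1, 0], !![0, -Complex.I; Complex.I, 0], !![1, 0; 0, -1]]

lemma ivdw_mul_ivdw (a b : Fin 4) (A A' B B' : Fin 2) :
    ivdw a A A' * ivdw b B B' = (1 / 2) * (pauli a A A' * pauli b B B') := by
  have hr : ((√2 : ℝ) : ℂ)⁻¹ * ((√2 : ℝ) : ℂ)⁻¹ = 1 / 2 := by
    rw [← mul_inv, ← Complex.ofReal_mul, Real.mul_self_sqrt (by norm_num)]
    norm_num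
  simp only [ivdw, Matrix.smul_apply, smul_eq_mul]
  change _ * pauli a A A' * (_ * pauli b B B') = _
  linear_combination pauli a A A' * pauli b B B' * hr

lemma spinorOfTensor_eq_pairSpinor {T : Fin 4 → Fin 4 → ℝ} (hT : ∀ a b, T a b = T b a)
    (htr : ∑ i, minkowski i i * T i i = 0) :
    spinorOfTensor T = pairSpinor (hermitianOfTensor T) := by
  have h : T 0 0 = T 1 1 + T 2 2 + T 3 3 := by
    simp [minkowski, Fin.sum_univ_four] at htr
    linarith
  funext A B A' B'
  simp only [spinorOfTensor, ivdw_mul_ivdw]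
  fin_cases A <;> fin_cases B <;> fin_cases A' <;> fin_cases B' <;>
    simp [Fin.sum_univ_four, pauli, pairSpinor, pairIndex, hermitianOfTensor, hT 1 0, hT 2 0,
      hT 3 0, hT 2 1, hT 3 1, hT 3 2] <;> apply Complex.ext <;> simp <;> linarith

/-- The trace-free symmetric tensor with given Hermitian matrix of spinor components. -/
def tensorOfHermitian (h : Matrix (Fin 3) (Fin 3) ℂ) : Fin 4 → Fin 4 → ℝ :=
  ![![((h 0 0).re + 2 * (h 1 1).re + (h 2 2).re) / 2, (h 0 1).re + (h 1 2).re,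
      -(h 0 1).im - (h 1 2).im, ((h 0 0).re - (h 2 2).re) / 2],
    ![(h 0 1).re + (h 1 2).re, (h 0 2).re + (h 1 1).re, -(h 0 2).im, (h 0 1).re - (h 1 2).re],
    ![-(h 0 1).im - (h 1 2).im, -(h 0 2).im, -(h 0 2).re + (h 1 1).re, -(h 0 1).im + (h 1 2).im],
    ![((h 0 0).re - (h 2 2).re) / 2, (h 0 1).re - (h 1 2).re, -(h 0 1).im + (h 1 2).im,
      ((h 0 0).re - 2 * (h 1 1).re + (h 2 2).re) / 2]]

lemma tensorOfHermitian_symm (h : Matrix (Fin 3) (Fin 3) ℂ) (a b : Fin 4) :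
    tensorOfHermitian h a b = tensorOfHermitian h b a := by
  fin_cases a <;> fin_cases b <;> rfl

lemma tensorOfHermitian_trace (h : Matrix (Fin 3) (Fin 3) ℂ) :
    ∑ i, minkowski i i * tensorOfHermitian h i i = 0 := by
  simp [minkowski, Fin.sum_univ_four, tensorOfHermitian]
  ring

lemma hermitianOfTensor_tensorOfHermitian {h : Matrix (Fin 3) (Fin 3) ℂ} (hh : h.IsHermitian) :
    hermitianOfTensor (tensorOfHermitian h) = h := by
  have h1 : ∀ i j, (h i j).re = (h j i).re := fun i j ↦ by
    rw [← hh.apply i j]; simp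
  have h2 : ∀ i j, (h i j).im = -(h j i).im := fun i j ↦ by
    rw [← hh.apply i j]; simp
  have h3 : ∀ i, (h i i).im = 0 := fun i ↦ by linarith [h2 i i]
  ext i j
  fin_cases i <;> fin_cases j <;> apply Complex.ext <;>
    simp [hermitianOfTensor, tensorOfHermitian, h1 1 0, h1 2 0, h1 2 1, h2 1 0, h2 2 0, h2 2 1, h3]
  all_goals ring

lemma im_invariants_eq_zero_of_symmetrize {T : Fin 4 → Fin 4 → ℝ} (hT : ∀ a b, T a b = T b a)
    (htr : ∑ i, minkowski i i * T i i = 0) {c : ℝ} (hc : c ≠ 0) {ψ : Spinor4}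
    (hψ : ∀ A B C D, symmetrize (spinorSquare (spinorOfTensor T)) A B C D = c * ψ A B C D) :
    (invI ψ).im = 0 ∧ (invJ ψ).im = 0 := by
  rw [spinorOfTensor_eq_pairSpinor hT htr, symmetrize_spinorSquare] at hψ
  set H := hermitianOfTensor T
  set K := H * symGram * Hᵀ with hK
  set t := 2 / 3 * (K 1 1 - K 0 2)
  have hc' : (c : ℂ) ≠ 0 := by exact_mod_cast hc
  have : ψ = pairSpinor (((c⁻¹ : ℝ) : ℂ) • K + ((c : ℂ)⁻¹ * t) • symGram⁻¹) := by
    funext A B C D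
    have := hψ A B C D
    simp only [pairSpinor, Matrix.add_apply, Matrix.smul_apply, smul_eq_mul] at this ⊢
    push_cast
    rw [mul_assoc, ← mul_add, this, inv_mul_cancel_left₀ hc']
  rw [this]
  refine im_invariants_eq_zero_of_hermitian (isHermitian_hermitianOfTensor T) c⁻¹ _ rfl ?_
  simp [symGram_inv, t]
  ring

lemma exists_tensor_of_im_invariants_eq_zero {X : Matrix (Fin 3) (Fin 3) ℂ} (hX : Xᵀ = X)
    (hX' : X 0 2 = X 1 1) (hI : (invI (pairSpinor X)).im = 0) (hJ : (invJ (pairSpinor X)).im = 0)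
    (c : ℝ) : ∃ T : Fin 4 → Fin 4 → ℝ, (∀ a b, T a b = T b a) ∧
      ∑ i, minkowski i i * T i i = 0 ∧
      ∀ A B C D, symmetrize (spinorSquare (spinorOfTensor T)) A B C D
        = c * pairSpinor X A B C D := by
  rw [invI_pairSpinor X hX] at hI
  rw [invJ_pairSpinor] at hJ
  have h20 : X 2 0 = X 0 2 := congrFun (congrFun hX 0) 2
  have htr : (X * symGram).trace = 0 := by
    simp [trace_fin_three, Matrix.mul_apply, Fin.sum_univ_three, symGram, hX', h20]
    ring
  obtain ⟨H, hH, t, ht⟩ := exists_hermitian_mul_symGram_of_real_invariants (Ψ := (c : ℂ) • X)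
    (by simp [hX]) (by simp [htr])
    (by
      simp only [Matrix.smul_mul, Matrix.mul_smul, trace_smul, smul_eq_mul,
        Complex.im_ofReal_mul, hI, mul_zero])
    (by
      simp only [Matrix.smul_mul, Matrix.mul_smul, trace_smul, smul_eq_mul,
        Complex.im_ofReal_mul, hJ, mul_zero])
  refine ⟨tensorOfHermitian H, tensorOfHermitian_symm H, tensorOfHermitian_trace H, ?_⟩
  rw [spinorOfTensor_eq_pairSpinor (tensorOfHermitian_symm H) (tensorOfHermitian_trace H),
    hermitianOfTensor_tensorOfHermitian hH, symmetrize_spinorSquare, ht]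
  intro A B C D
  have : (c : ℂ) • X + t • symGram⁻¹ + (2 / 3 * (((c : ℂ) • X + t • symGram⁻¹) 1 1 -
      ((c : ℂ) • X + t • symGram⁻¹) 0 2)) • symGram⁻¹ = (c : ℂ) • X := by
    -- As X has no trace part, the correction made by symmetrising cancels the free multiple t of
    -- N⁻¹ exactly.
    have e : 2 / 3 * (((c : ℂ) • X + t • symGram⁻¹) 1 1 -
      ((c : ℂ) • X + t • symGram⁻¹) 0 2) = -t := by
      simp [symGram_inv, hX']
      ring
    rw [e, add_assoc, ← add_smul, add_neg_cancel, zero_smul, add_zero]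
  rw [this]
  rfl

end SpinorMatrices

/-! ### The Weyl spinor as a matrix on self-dual bivectors -/

section WeylSpinor

open Matrix

/-- The algebraic symmetries of the Weyl tensor in an orthonormal frame. -/
structure IsAlgebraicWeyl (W : Fin 4 → Fin 4 → Fin 4 → Fin 4 → ℝ) : Prop where
  antisymm_left : ∀ a b c d, W a b c d = -W b a c d
  antisymm_right : ∀ a b c d, W a b c d = -W a b d c
  pair : ∀ a b c d, W a b c d = W c d a b
  cyclic : ∀ a b c d, W a b c d + W b c a d + W c a b d = 0
  traceFree : ∀ b d, ∑ a, minkowski a a * W a b a d = 0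

/-- The components of the self-dual part of a bivector. -/
def selfDualPart (w : Fin 4 → Fin 4 → ℂ) : Fin 3 → ℂ :=
  ![w 0 1 + Complex.I * w 2 3, w 0 2 + Complex.I * w 3 1, w 0 3 + Complex.I * w 1 2]

/-- The symmetric spinors belonging to the coordinate self-dual bivectors. -/
def selfDualBasis : Matrix (Fin 3) (Fin 3) ℂ :=
  !![-1, Complex.I, 0; 0, 0, 1; 1, Complex.I, 0]

/-- The matrix of a curvature-like tensor on self-dual bivectors. -/
def selfDualMatrix (W : Fin 4 → Fin 4 → Fin 4 → Fin 4 → ℝ) : Matrix (Fin 3) (Fin 3) ℂ := fun l m ↦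
  selfDualPart (fun a b ↦ selfDualPart (fun c d ↦ (W a b c d : ℂ)) m) l

/-- Contracting the primed indices with ε annihilates one of the two duality parts of a bivector;
`selfDualBasis` rewrites the surviving three components as a symmetric spinor. -/
lemma contract_eps_bivector {w : Fin 4 → Fin 4 → ℂ} (hw : ∀ a b, w a b = -w b a) (A B : Fin 2) :
    ∑ A', ∑ B', (∑ a, ∑ b, ivdw a A A' * ivdw b B B' * w a b) * eps A' B'
      = -(selfDualBasis *ᵥ selfDualPart w) (pairIndex A B) := by
  have h0 : ∀ a, w a a = 0 := fun a ↦ by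
    have := hw a a
    linear_combination this / 2
  simp only [ivdw_mul_ivdw]
  fin_cases A <;> fin_cases B <;>
    simp [Fin.sum_univ_four, Fin.sum_univ_two, pauli, eps, pairIndex, selfDualBasis, mulVec,
      dotProduct, Fin.sum_univ_three, selfDualPart, h0, hw 1 0, hw 2 0, hw 3 0, hw 2 1, hw 3 1,
      hw 3 2] <;> ring_nf <;> simp [Complex.I_sq] <;> ring

lemma sum_sum_comm {ι κ R : Type*} [Fintype ι] [Fintype κ] [AddCommMonoid R]
    (f : ι → ι → κ → κ → R) :
    ∑ x, ∑ y, ∑ a, ∑ b, f x y a b = ∑ a, ∑ b, ∑ x, ∑ y, f x y a b := by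
  have h1 : ∀ x y, ∑ a, ∑ b, f x y a b = ∑ p : κ × κ, f x y p.1 p.2 := fun x y ↦
    (Fintype.sum_prod_type fun p : κ × κ ↦ f x y p.1 p.2).symm
  have h2 : ∀ a b, ∑ x, ∑ y, f x y a b = ∑ p : ι × ι, f p.1 p.2 a b := fun a b ↦
    (Fintype.sum_prod_type fun p : ι × ι ↦ f p.1 p.2 a b).symm
  simp only [h1, h2]
  rw [← Fintype.sum_prod_type (fun p : ι × ι ↦ ∑ q : κ × κ, f p.1 p.2 q.1 q.2),
    ← Fintype.sum_prod_type (fun q : κ × κ ↦ ∑ p : ι × ι, f p.1 p.2 q.1 q.2)]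
  exact Finset.sum_comm

lemma weylSpinor_eq_pairSpinor {W : Fin 4 → Fin 4 → Fin 4 → Fin 4 → ℝ}
    (h1 : ∀ a b c d, W a b c d = -W b a c d) (h2 : ∀ a b c d, W a b c d = -W a b d c) :
    weylSpinor W
      = pairSpinor ((1 / 4 : ℂ) • (selfDualBasis * selfDualMatrix W * selfDualBasisᵀ)) := by
  funext A B C D
  have e1 : ∀ A' B', ∑ C', ∑ D', (∑ a, ∑ b, ∑ c, ∑ d,
      ivdw a A A' * ivdw b B B' * ivdw c C C' * ivdw d D D' * (W a b c d : ℂ))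
      * eps A' B' * eps C' D' = (∑ a, ∑ b, ivdw a A A' * ivdw b B B' *
        (∑ C', ∑ D', (∑ c, ∑ d, ivdw c C C' * ivdw d D D' * (W a b c d : ℂ)) * eps C' D'))
          * eps A' B' := by
    intro A' B'
    simp only [Finset.mul_sum, Finset.sum_mul]
    refine (sum_sum_comm _).trans ?_
    refine Finset.sum_congr rfl fun a _ ↦ Finset.sum_congr rfl fun b _ ↦ Finset.sum_congr rfl
      fun C' _ ↦ Finset.sum_congr rfl fun D' _ ↦ Finset.sum_congr rfl fun c _ ↦
        Finset.sum_congr rfl fun d _ ↦ ?_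
    ring
  simp only [weylSpinor, e1]
  have e2 : ∀ a b, ∑ C', ∑ D', (∑ c, ∑ d, ivdw c C C' * ivdw d D D' * (W a b c d : ℂ)) * eps C' D'
      = -(selfDualBasis *ᵥ selfDualPart fun c d ↦ (W a b c d : ℂ)) (pairIndex C D) := fun a b ↦
    contract_eps_bivector (fun c d ↦ by rw [h2]; simp) C D
  simp only [e2]
  rw [contract_eps_bivector (fun a b ↦ by
    have : (fun c d ↦ (W a b c d : ℂ)) = -(fun c d ↦ (W b a c d : ℂ)) := by
      funext c d; simp [h1 a b]
    rw [this]
    simp [mulVec, dotProduct, Fin.sum_univ_three, selfDualPart]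
    ring)]
  simp only [pairSpinor]
  generalize pairIndex A B = i
  generalize pairIndex C D = j
  simp only [Matrix.smul_apply, Matrix.mul_apply, mulVec, dotProduct, Fin.sum_univ_three,
    selfDualMatrix, selfDualPart, transpose_apply, smul_eq_mul]
  simp
  ring

/-- A multiple of the identity on self-dual bivectors thereby becomes a multiple of N⁻¹, that is, a
pure trace term. -/
lemma selfDualBasis_mul_transpose :
    selfDualBasis * selfDualBasisᵀ = (-2 : ℂ) • symGram⁻¹ := by
  rw [symGram_inv]
  ext i j
  fin_cases i <;> fin_cases j <;>
    simp [selfDualBasis, Matrix.mul_apply, Fin.sum_univ_three] <;> norm_num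

lemma IsAlgebraicWeyl.selfDualMatrix_transpose {W : Fin 4 → Fin 4 → Fin 4 → Fin 4 → ℝ}
    (hW : IsAlgebraicWeyl W) : (selfDualMatrix W)ᵀ = selfDualMatrix W := by
  ext l m
  have h := fun a b c d ↦ congrArg (fun x : ℝ ↦ (x : ℂ)) (hW.pair a b c d)
  fin_cases l <;> fin_cases m <;> simp [selfDualMatrix, selfDualPart]
  · linear_combination h 0 2 0 1 + Complex.I * h 0 2 2 3 + Complex.I * h 3 1 0 1 +
      Complex.I ^ 2 * h 3 1 2 3
  · linear_combination h 0 3 0 1 + Complex.I * h 0 3 2 3 + Complex.I * h 1 2 0 1 +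
      Complex.I ^ 2 * h 1 2 2 3
  · linear_combination h 0 1 0 2 + Complex.I * h 0 1 3 1 + Complex.I * h 2 3 0 2 +
      Complex.I ^ 2 * h 2 3 3 1
  · linear_combination h 0 3 0 2 + Complex.I * h 0 3 3 1 + Complex.I * h 1 2 0 2 +
      Complex.I ^ 2 * h 1 2 3 1
  · linear_combination h 0 1 0 3 + Complex.I * h 0 1 1 2 + Complex.I * h 2 3 0 3 +
      Complex.I ^ 2 * h 2 3 1 2
  · linear_combination h 0 2 0 3 + Complex.I * h 0 2 1 2 + Complex.I * h 3 1 0 3 +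
      Complex.I ^ 2 * h 3 1 1 2

/-- The real part vanishes by trace-freeness of W, the imaginary part by the cyclic identity. -/
lemma IsAlgebraicWeyl.trace_selfDualMatrix {W : Fin 4 → Fin 4 → Fin 4 → Fin 4 → ℝ}
    (hW : IsAlgebraicWeyl W) : (selfDualMatrix W).trace = 0 := by
  have d1 : ∀ a c d, W a a c d = 0 := fun a c d ↦ by linarith [hW.antisymm_left a a c d]
  have t0 := hW.traceFree 0 0
  have t1 := hW.traceFree 1 1
  have t2 := hW.traceFree 2 2
  have t3 := hW.traceFree 3 3
  simp [minkowski, Fin.sum_univ_four, d1] at t0 t1 t2 t3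
  have r : ∀ a b, W a b a b = W b a b a := fun a b ↦ by
    rw [hW.antisymm_left, hW.antisymm_right, neg_neg]
  rw [trace_fin_three]
  apply Complex.ext
  · simp [selfDualMatrix, selfDualPart]
    linarith [r 0 1, r 0 2, r 0 3, r 1 2, r 1 3, r 2 3]
  · simp [selfDualMatrix, selfDualPart]
    linarith [hW.cyclic 1 2 3 0, hW.pair 0 1 2 3, hW.pair 0 2 3 1, hW.pair 0 3 1 2,
      hW.antisymm_right 2 3 0 1, hW.antisymm_right 3 1 0 2, hW.antisymm_right 1 2 0 3]

lemma IsAlgebraicWeyl.exists_weylSpinor_eq {W : Fin 4 → Fin 4 → Fin 4 → Fin 4 → ℝ}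
    (hW : IsAlgebraicWeyl W) : ∃ X : Matrix (Fin 3) (Fin 3) ℂ,
      weylSpinor W = pairSpinor X ∧
      X = (1 / 4 : ℂ) • (selfDualBasis * selfDualMatrix W * selfDualBasisᵀ) ∧
      Xᵀ = X ∧ X 0 2 = X 1 1 := by
  refine ⟨_, weylSpinor_eq_pairSpinor hW.antisymm_left hW.antisymm_right, rfl, ?_, ?_⟩
  · simp only [transpose_smul, transpose_mul, transpose_transpose, hW.selfDualMatrix_transpose,
      Matrix.mul_assoc]
  · have h := hW.trace_selfDualMatrix
    have h10 : selfDualMatrix W 1 0 = selfDualMatrix W 0 1 :=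
      congrFun (congrFun hW.selfDualMatrix_transpose 0) 1
    rw [trace_fin_three] at h
    have h22 : selfDualMatrix W 2 2 = -selfDualMatrix W 0 0 - selfDualMatrix W 1 1 := by
      linear_combination h
    generalize selfDualMatrix W = Q at *
    simp only [Matrix.smul_apply, Matrix.mul_apply, Fin.sum_univ_three, transpose_apply, h10, h22]
    simp [selfDualBasis]
    linear_combination Q 1 1 * Complex.I_sq

/-- Evaluated entry by entry so that the comparison with H N Hᵀ becomes a polynomial identity in the
components of h. -/
lemma selfDualMatrix_hypersurface {h : Fin 4 → Fin 4 → ℝ} (hh : ∀ a b, h a b = h b a) :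
    selfDualMatrix (fun a b c d ↦ h a d * h b c - h b d * h a c) =
      !![⟨h 0 1 ^ 2 - h 0 0 * h 1 1 - h 2 3 ^ 2 + h 2 2 * h 3 3,
            2 * (h 0 3 * h 1 2 - h 1 3 * h 0 2)⟩,
          ⟨h 0 2 * h 0 1 - h 0 0 * h 1 2 - h 1 2 * h 3 3 + h 2 3 * h 1 3,
            h 0 1 * h 1 3 - h 1 1 * h 0 3 + h 0 3 * h 2 2 - h 0 2 * h 2 3⟩,
          ⟨h 0 1 * h 0 3 - h 0 0 * h 1 3 + h 2 3 * h 1 2 - h 1 3 * h 2 2,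
            h 1 1 * h 0 2 - h 0 1 * h 1 2 + h 0 3 * h 2 3 - h 0 2 * h 3 3⟩;
        ⟨h 0 2 * h 0 1 - h 0 0 * h 1 2 - h 1 2 * h 3 3 + h 2 3 * h 1 3,
            h 0 1 * h 1 3 - h 1 1 * h 0 3 + h 0 3 * h 2 2 - h 0 2 * h 2 3⟩,
          ⟨h 0 2 ^ 2 - h 0 0 * h 2 2 - h 1 3 ^ 2 + h 1 1 * h 3 3,
            2 * (h 0 1 * h 2 3 - h 0 3 * h 1 2)⟩,
          ⟨h 0 2 * h 0 3 - h 0 0 * h 2 3 + h 1 2 * h 1 3 - h 2 3 * h 1 1,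
            h 0 2 * h 1 2 - h 0 1 * h 2 2 + h 0 1 * h 3 3 - h 0 3 * h 1 3⟩;
        ⟨h 0 1 * h 0 3 - h 0 0 * h 1 3 + h 2 3 * h 1 2 - h 1 3 * h 2 2,
            h 1 1 * h 0 2 - h 0 1 * h 1 2 + h 0 3 * h 2 3 - h 0 2 * h 3 3⟩,
          ⟨h 0 2 * h 0 3 - h 0 0 * h 2 3 + h 1 2 * h 1 3 - h 2 3 * h 1 1,
            h 0 2 * h 1 2 - h 0 1 * h 2 2 + h 0 1 * h 3 3 - h 0 3 * h 1 3⟩,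
          ⟨h 0 3 ^ 2 - h 0 0 * h 3 3 - h 1 2 ^ 2 + h 1 1 * h 2 2,
            2 * (h 0 2 * h 1 3 - h 0 1 * h 2 3)⟩] := by
  ext l m
  fin_cases l <;> fin_cases m <;>
    simp only [selfDualMatrix, selfDualPart, hh 1 0, hh 2 0, hh 3 0, hh 2 1,
      hh 3 1, hh 3 2] <;> apply Complex.ext <;> simp <;> ring

/-- The spinor form of the Gauss equation. No trace condition on h is needed, because the trace of h
affects only the multiple of N⁻¹; the witness t is dictated by the entry (0, 2). -/
lemma conj_selfDualMatrix_hypersurface {h : Fin 4 → Fin 4 → ℝ} (hh : ∀ a b, h a b = h b a) :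
    ∃ t : ℂ, (1 / 4 : ℂ) • (selfDualBasis *
        selfDualMatrix (fun a b c d ↦ h a d * h b c - h b d * h a c) * selfDualBasisᵀ)
      = ((-1 / 2 : ℝ) : ℂ) • (hermitianOfTensor h * symGram * (hermitianOfTensor h)ᵀ)
        + t • symGram⁻¹ := by
  rw [selfDualMatrix_hypersurface hh, symGram_inv]
  refine ⟨⟨(h 0 0 ^ 2 + h 1 1 ^ 2 + h 2 2 ^ 2 + h 3 3 ^ 2) / 8 + (h 0 0 * h 1 1 + h 0 0 * h 2 2
    + h 0 0 * h 3 3 - h 1 1 * h 2 2 - h 1 1 * h 3 3 - h 2 2 * h 3 3) / 4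
    + (h 1 2 ^ 2 + h 1 3 ^ 2 + h 2 3 ^ 2 - h 0 1 ^ 2 - h 0 2 ^ 2 - h 0 3 ^ 2) / 2, 0⟩, ?_⟩
  ext i j
  simp only [Matrix.smul_apply, Matrix.add_apply, Matrix.mul_apply, Fin.sum_univ_three,
    transpose_apply]
  fin_cases i <;> fin_cases j <;>
    simp [selfDualBasis, hermitianOfTensor, symGram] <;>
    apply Complex.ext <;> simp <;> ring

/-- In the product of the metric with θ, the trace-free part of θ maps self-dual to anti-self-dual
bivectors and is invisible here; the trace of θ acts as a scalar. -/
lemma selfDualMatrix_trace_part {W V : Fin 4 → Fin 4 → Fin 4 → Fin 4 → ℝ} {θ : Fin 4 → Fin 4 → ℝ}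
    {κ : ℝ} (hθ : ∀ a b, θ a b = θ b a)
    (hWV : ∀ a b c d, W a b c d = κ * V a b c d +
      (minkowski a c * θ b d - minkowski a d * θ b c - minkowski b c * θ a d
        + minkowski b d * θ a c)) :
    selfDualMatrix W = (κ : ℂ) • selfDualMatrix V
      + ((θ 1 1 + θ 2 2 + θ 3 3 - θ 0 0 : ℝ) : ℂ) • 1 := by
  ext l m
  simp only [Matrix.add_apply, Matrix.smul_apply, selfDualMatrix, selfDualPart, hWV]
  fin_cases l <;> fin_cases m <;>
    simp [minkowski, hθ 1 0, hθ 2 0, hθ 3 0, hθ 2 1, hθ 3 1, hθ 3 2] <;>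
    apply Complex.ext <;> simp <;> ring

/-- The Weyl spinor of a tensor that is, up to pure trace terms, `h_{ad} h_{bc} - h_{bd} h_{ac}`
has real invariants. -/
lemma IsAlgebraicWeyl.im_invariants_eq_zero {W : Fin 4 → Fin 4 → Fin 4 → Fin 4 → ℝ}
    (hW : IsAlgebraicWeyl W) {h θ : Fin 4 → Fin 4 → ℝ} {κ : ℝ} (hh : ∀ a b, h a b = h b a)
    (hθ : ∀ a b, θ a b = θ b a)
    (hWh : ∀ a b c d, W a b c d = κ * (h a d * h b c - h b d * h a c) +
      (minkowski a c * θ b d - minkowski a d * θ b c - minkowski b c * θ a d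
        + minkowski b d * θ a c)) :
    (invI (weylSpinor W)).im = 0 ∧ (invJ (weylSpinor W)).im = 0 := by
  obtain ⟨X, hWX, hX, hXT, hX'⟩ := hW.exists_weylSpinor_eq
  rw [hWX]
  obtain ⟨t, ht⟩ := conj_selfDualMatrix_hypersurface hh
  rw [selfDualMatrix_trace_part hθ hWh, Matrix.mul_add, Matrix.add_mul, Matrix.mul_smul,
    Matrix.smul_mul, Matrix.mul_smul, Matrix.smul_mul, Matrix.mul_one, selfDualBasis_mul_transpose,
    smul_add, smul_comm _ (κ : ℂ), ht, smul_add, smul_smul, smul_smul, smul_smul, smul_smul,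
    add_assoc, ← add_smul, ← Complex.ofReal_mul] at hX
  exact im_invariants_eq_zero_of_hermitian (isHermitian_hermitianOfTensor h) _ _ hX hX'

end WeylSpinor

/-! ### Symmetries of the coordinate curvature tensor -/

section CoordinateCurvature

lemma pd_congr {f g : E4 → ℝ} {y : E4} (h : f =ᶠ[𝓝 y] g) (k : Fin 4) : pd k f y = pd k g y := by
  rw [pd, pd, h.fderiv_eq]

lemma pd_add {f g : E4 → ℝ} {y : E4} (hf : DifferentiableAt ℝ f y) (hg : DifferentiableAt ℝ g y)
    (k : Fin 4) : pd k (fun z ↦ f z + g z) y = pd k f y + pd k g y := by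
  rw [pd, fderiv_fun_add hf hg]; rfl

lemma pd_sub {f g : E4 → ℝ} {y : E4} (hf : DifferentiableAt ℝ f y) (hg : DifferentiableAt ℝ g y)
    (k : Fin 4) : pd k (fun z ↦ f z - g z) y = pd k f y - pd k g y := by
  rw [pd, fderiv_fun_sub hf hg]; rfl

lemma pd_mul {f g : E4 → ℝ} {y : E4} (hf : DifferentiableAt ℝ f y) (hg : DifferentiableAt ℝ g y)
    (k : Fin 4) : pd k (fun z ↦ f z * g z) y = f y * pd k g y + pd k f y * g y := by
  rw [pd, fderiv_fun_mul hf hg]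
  simp [pd]
  ring

lemma pd_const_mul {f : E4 → ℝ} {y : E4} (hf : DifferentiableAt ℝ f y) (c : ℝ)
    (k : Fin 4) : pd k (fun z ↦ c * f z) y = c * pd k f y := by
  rw [pd, fderiv_const_mul hf]; rfl

lemma pd_sum {ι : Type*} {s : Finset ι} {f : ι → E4 → ℝ} {y : E4}
    (hf : ∀ i ∈ s, DifferentiableAt ℝ (f i) y) (k : Fin 4) :
    pd k (fun z ↦ ∑ i ∈ s, f i z) y = ∑ i ∈ s, pd k (f i) y := by
  rw [pd, fderiv_fun_sum hf]
  simp [pd]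

lemma contDiffAt_pd {f : E4 → ℝ} {y : E4} {m n : WithTop ℕ∞} (hf : ContDiffAt ℝ n f y)
    (hmn : m + 1 ≤ n) (k : Fin 4) : ContDiffAt ℝ m (pd k f) y :=
  (hf.fderiv_right hmn).clm_apply contDiffAt_const

lemma pd_comm {f : E4 → ℝ} {y : E4} (hf : ContDiffAt ℝ 2 f y) (j k : Fin 4) :
    pd j (pd k f) y = pd k (pd j f) y := by
  have h : ∀ j k : Fin 4, pd j (pd k f) y
      = fderiv ℝ (fderiv ℝ f) y (EuclideanSpace.single j 1) (EuclideanSpace.single k 1) := by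
    intro j k
    have hd : DifferentiableAt ℝ (fderiv ℝ f) y :=
      (hf.fderiv_right (m := 1) (by norm_num)).differentiableAt (by norm_num)
    change fderiv ℝ (fun z ↦ fderiv ℝ f z (EuclideanSpace.single k 1)) y _ = _
    rw [fderiv_clm_apply hd (differentiableAt_const _)]
    simp
  rw [h, h]
  exact hf.isSymmSndFDerivAt (by simp) _ _

/-- A germ of a nondegenerate symmetric matrix-valued function, three times continuously
differentiable. -/
structure IsMetricGerm (G : E4 → Matrix (Fin 4) (Fin 4) ℝ) (y : E4) : Prop where
  smooth : ∀ i j, ContDiffAt ℝ 3 (fun z ↦ G z i j) y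
  symm : ∀ᶠ z in 𝓝 y, (G z).transpose = G z
  det_ne_zero : (G y).det ≠ 0

/-- The Christoffel symbols of the first kind, `Γ_{d,ab}`. -/
def christoffelLow (G : E4 → Matrix (Fin 4) (Fin 4) ℝ) (d a b : Fin 4) (y : E4) : ℝ :=
  (1 / 2) * (pd a (fun z ↦ G z d b) y + pd b (fun z ↦ G z a d) y - pd d (fun z ↦ G z a b) y)

variable {G : E4 → Matrix (Fin 4) (Fin 4) ℝ} {y : E4}

lemma christoffel_eq (c a b : Fin 4) (y : E4) :
    christoffel G c a b y = ∑ d, (G y)⁻¹ c d * christoffelLow G d a b y := by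
  simp only [christoffel, christoffelLow, Finset.mul_sum]
  refine Finset.sum_congr rfl fun d _ ↦ ?_
  ring

lemma contDiffAt_matrix_det {n : WithTop ℕ∞} {A : E4 → Matrix (Fin 4) (Fin 4) ℝ}
    (h : ∀ i j, ContDiffAt ℝ n (fun z ↦ A z i j) y) : ContDiffAt ℝ n (fun z ↦ (A z).det) y := by
  simp only [Matrix.det_apply']
  exact ContDiffAt.sum fun σ _ ↦ contDiffAt_const.mul (contDiffAt_prod fun _ _ ↦ h _ _)

namespace IsMetricGerm

lemma eventually (hG : IsMetricGerm G y) : ∀ᶠ z in 𝓝 y, IsMetricGerm G z := by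
  have h1 : ∀ᶠ z in 𝓝 y, ∀ i j, ContDiffAt ℝ 3 (fun x ↦ G x i j) z := by
    rw [Filter.eventually_all]
    intro i
    rw [Filter.eventually_all]
    intro j
    exact (hG.smooth i j).eventually (by norm_num)
  have h2 : ∀ᶠ z in 𝓝 y, (G z).det ≠ 0 :=
    (contDiffAt_matrix_det hG.smooth).continuousAt.eventually_ne hG.det_ne_zero
  filter_upwards [h1, h2, hG.symm.eventually_nhds] with z hz1 hz2 hz3 using ⟨hz1, hz3, hz2⟩

lemma symm_apply (hG : IsMetricGerm G y) (i j : Fin 4) : G y i j = G y j i :=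
  congrFun (congrFun hG.symm.self_of_nhds j) i

lemma inv_symm (hG : IsMetricGerm G y) (i j : Fin 4) : (G y)⁻¹ i j = (G y)⁻¹ j i := by
  have : ((G y)⁻¹).transpose = (G y)⁻¹ := by
    rw [Matrix.transpose_nonsing_inv, hG.symm.self_of_nhds]
  exact congrFun (congrFun this j) i

lemma mul_inv (hG : IsMetricGerm G y) : G y * (G y)⁻¹ = 1 :=
  Matrix.mul_nonsing_inv _ (isUnit_iff_ne_zero.mpr hG.det_ne_zero)

lemma contDiffAt_inv (hG : IsMetricGerm G y) (i j : Fin 4) :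
    ContDiffAt ℝ 3 (fun z ↦ (G z)⁻¹ i j) y := by
  simp only [Matrix.inv_def, Matrix.smul_apply, Ring.inverse_eq_inv', Matrix.adjugate_apply]
  refine ((contDiffAt_matrix_det hG.smooth).inv hG.det_ne_zero).smul (contDiffAt_matrix_det ?_)
  intro k l
  simp only [Matrix.updateRow_apply]
  split_ifs
  · exact contDiffAt_const
  · exact hG.smooth _ _

lemma pd_symm (hG : IsMetricGerm G y) (k i j : Fin 4) :
    pd k (fun z ↦ G z i j) y = pd k (fun z ↦ G z j i) y :=
  pd_congr (hG.symm.mono fun _ hz ↦ congrFun (congrFun hz j) i) k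

lemma christoffelLow_symm (hG : IsMetricGerm G y) (d a b : Fin 4) :
    christoffelLow G d a b y = christoffelLow G d b a y := by
  simp only [christoffelLow]
  rw [hG.pd_symm a d b, hG.pd_symm b a d, hG.pd_symm d a b]
  ring

lemma pd_eq (hG : IsMetricGerm G y) (a k d : Fin 4) :
    pd a (fun z ↦ G z k d) y = christoffelLow G k a d y + christoffelLow G d a k y := by
  simp only [christoffelLow]
  rw [hG.pd_symm a d k]
  ring

lemma contDiffAt_christoffelLow (hG : IsMetricGerm G y) (d a b : Fin 4) :
    ContDiffAt ℝ 2 (christoffelLow G d a b) y := by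
  have h : ∀ i j k, ContDiffAt ℝ 2 (pd k (fun z ↦ G z i j)) y := fun i j k ↦
    contDiffAt_pd (hG.smooth i j) (by norm_num) k
  exact contDiffAt_const.mul (((h _ _ _).add (h _ _ _)).sub (h _ _ _))

lemma contDiffAt_christoffel (hG : IsMetricGerm G y) (d a b : Fin 4) :
    ContDiffAt ℝ 2 (christoffel G d a b) y := by
  have : christoffel G d a b = fun z ↦ ∑ e, (G z)⁻¹ d e * christoffelLow G e a b z :=
    funext fun z ↦ christoffel_eq d a b z
  rw [this]
  exact ContDiffAt.sum fun e _ ↦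
    ((hG.contDiffAt_inv d e).of_le (by norm_num)).mul (hG.contDiffAt_christoffelLow e a b)

lemma lower_christoffel (hG : IsMetricGerm G y) (k a b : Fin 4) :
    ∑ d, G y k d * christoffel G d a b y = christoffelLow G k a b y := by
  have : (G y).mulVec ((G y)⁻¹.mulVec fun e ↦ christoffelLow G e a b y) k
      = christoffelLow G k a b y := by
    rw [Matrix.mulVec_mulVec, hG.mul_inv, Matrix.one_mulVec]
  rw [← this]
  simp only [Matrix.mulVec, dotProduct, christoffel_eq]

/-- Differentiating G Γ = Γ_low avoids derivatives of the inverse metric; metric compatibility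
(`pd_eq`) rewrites the derivative of G. -/
lemma lower_pd_christoffel (hG : IsMetricGerm G y) (a k b c : Fin 4) :
    ∑ d, G y k d * pd a (christoffel G d b c) y = pd a (christoffelLow G k b c) y
      - ∑ d, (christoffelLow G k a d y + christoffelLow G d a k y) * christoffel G d b c y := by
  have h : christoffelLow G k b c =ᶠ[𝓝 y] fun z ↦ ∑ d, G z k d * christoffel G d b c z :=
    hG.eventually.mono fun z hz ↦ (hz.lower_christoffel k b c).symm
  have d1 : ∀ d, DifferentiableAt ℝ (fun z ↦ G z k d) y := fun d ↦
    (hG.smooth k d).differentiableAt (by norm_num)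
  have d2 : ∀ d, DifferentiableAt ℝ (christoffel G d b c) y := fun d ↦
    (hG.contDiffAt_christoffel d b c).differentiableAt (by norm_num)
  rw [pd_congr h, pd_sum (f := fun d z ↦ G z k d * christoffel G d b c z)
    fun d _ ↦ (d1 d).mul (d2 d), ← Finset.sum_sub_distrib]
  refine Finset.sum_congr rfl fun d _ ↦ ?_
  rw [pd_mul (d1 d) (d2 d), hG.pd_eq]
  ring

/-- In lowered form half of the quadratic terms cancel against those coming from ∂G, leaving only
products of first-kind symbols. -/
lemma riemann_eq (hG : IsMetricGerm G y) (a b c d : Fin 4) :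
    riemann G a b c d y = pd a (christoffelLow G d b c) y - pd b (christoffelLow G d a c) y
      - ∑ e, ∑ f, (G y)⁻¹ e f * (christoffelLow G e a d y * christoffelLow G f b c y)
      + ∑ e, ∑ f, (G y)⁻¹ e f * (christoffelLow G e b d y * christoffelLow G f a c y) := by
  have h1 : ∀ a b c, ∑ e, ∑ f, (G y)⁻¹ e f * (christoffelLow G e a d y * christoffelLow G f b c y)
      = ∑ e, christoffelLow G e a d y * christoffel G e b c y := by
    intro a b c
    refine Finset.sum_congr rfl fun e _ ↦ ?_
    rw [christoffel_eq, Finset.mul_sum]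
    refine Finset.sum_congr rfl fun f _ ↦ ?_
    ring
  have h2 : ∀ a b c, ∑ e, G y d e * ∑ f, christoffel G e a f y * christoffel G f b c y
      = ∑ f, christoffelLow G d a f y * christoffel G f b c y := by
    intro a b c
    simp only [Finset.mul_sum]
    rw [Finset.sum_comm]
    refine Finset.sum_congr rfl fun f _ ↦ ?_
    rw [← hG.lower_christoffel d a f, Finset.sum_mul]
    refine Finset.sum_congr rfl fun e _ ↦ ?_
    ring
  have h3 : riemann G a b c d y = ∑ e, G y d e * pd a (christoffel G e b c) y
      - ∑ e, G y d e * pd b (christoffel G e a c) y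
      + ∑ e, G y d e * ∑ f, christoffel G e a f y * christoffel G f b c y
      - ∑ e, G y d e * ∑ f, christoffel G e b f y * christoffel G f a c y := by
    simp only [riemann, riemannUp, ← Finset.sum_sub_distrib, ← Finset.sum_add_distrib]
    refine Finset.sum_congr rfl fun e _ ↦ ?_
    rw [hG.symm_apply e d, Finset.sum_sub_distrib]
    ring
  rw [h3, hG.lower_pd_christoffel, hG.lower_pd_christoffel, h2, h2, h1, h1]
  simp only [add_mul, Finset.sum_add_distrib]
  ring

lemma pd_christoffelLow (hG : IsMetricGerm G y) (k d a b : Fin 4) :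
    pd k (christoffelLow G d a b) y = (1 / 2) * (pd k (pd a (fun z ↦ G z d b)) y
      + pd k (pd b (fun z ↦ G z a d)) y - pd k (pd d (fun z ↦ G z a b)) y) := by
  have h : ∀ i j k, DifferentiableAt ℝ (pd k (fun z ↦ G z i j)) y := fun i j k ↦
    (contDiffAt_pd (m := 2) (hG.smooth i j) (by norm_num) k).differentiableAt (by norm_num)
  have e1 := pd_add (h d b a) (h a d b) k
  have e2 := pd_sub ((h d b a).add (h a d b)) (h a b d) k
  have e3 := pd_const_mul (((h d b a).add (h a d b)).sub (h a b d)) (1 / 2) k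
  exact e3.trans (congrArg _ (e2.trans (congrArg (· - _) e1)))

lemma pd_pd_symm (hG : IsMetricGerm G y) (k l i j : Fin 4) :
    pd k (pd l (fun z ↦ G z i j)) y = pd k (pd l (fun z ↦ G z j i)) y :=
  pd_congr (hG.eventually.mono fun _ hz ↦ hz.pd_symm l i j) k

lemma pd_pd_comm (hG : IsMetricGerm G y) (k l i j : Fin 4) :
    pd k (pd l (fun z ↦ G z i j)) y = pd l (pd k (fun z ↦ G z i j)) y :=
  pd_comm ((hG.smooth i j).of_le (by norm_num)) k l

/-- The curvature in terms of second derivatives of the metric and products of Christoffel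
symbols. -/
lemma exists_riemann_eq (hG : IsMetricGerm G y) :
    ∃ H P : Fin 4 → Fin 4 → Fin 4 → Fin 4 → ℝ,
      (∀ a b c d, H a b c d = H b a c d) ∧ (∀ a b c d, H a b c d = H a b d c) ∧
      (∀ a b c d, P a b c d = P b a c d) ∧ (∀ a b c d, P a b c d = P c d a b) ∧
      ∀ a b c d, riemann G a b c d y
        = (1 / 2) * (H a c b d - H a d b c - H b c a d + H b d a c) - P a d b c + P b d a c := by
  refine ⟨fun a b c d ↦ pd a (pd b (fun z ↦ G z c d)) y, fun a b c d ↦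
    ∑ e, ∑ f, (G y)⁻¹ e f * (christoffelLow G e a b y * christoffelLow G f c d y),
    fun a b c d ↦ hG.pd_pd_comm _ _ _ _, fun a b c d ↦ hG.pd_pd_symm _ _ _ _, ?_, ?_, ?_⟩
  · intro a b c d
    simp only [hG.christoffelLow_symm _ a b]
  · intro a b c d
    dsimp only
    rw [Finset.sum_comm]
    refine Finset.sum_congr rfl fun e _ ↦ Finset.sum_congr rfl fun f _ ↦ ?_
    rw [hG.inv_symm f e]
    ring
  · intro a b c d
    rw [hG.riemann_eq, hG.pd_christoffelLow, hG.pd_christoffelLow]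
    linarith [hG.pd_pd_comm a b d c, hG.pd_pd_symm b c a d, hG.pd_pd_symm a c b d]

lemma riemann_antisymm_left (hG : IsMetricGerm G y) (a b c d : Fin 4) :
    riemann G a b c d y = -riemann G b a c d y := by
  obtain ⟨H, P, h1, h2, h3, h4, h5⟩ := hG.exists_riemann_eq
  rw [h5, h5]
  ring

lemma riemann_antisymm_right (hG : IsMetricGerm G y) (a b c d : Fin 4) :
    riemann G a b c d y = -riemann G a b d c y := by
  obtain ⟨H, P, h1, h2, h3, h4, h5⟩ := hG.exists_riemann_eq
  rw [h5, h5, h4 a c, h4 b c]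
  ring

lemma riemann_pair (hG : IsMetricGerm G y) (a b c d : Fin 4) :
    riemann G a b c d y = riemann G c d a b y := by
  obtain ⟨H, P, h1, h2, h3, h4, h5⟩ := hG.exists_riemann_eq
  have h6 : ∀ a b c d, P a b c d = P a b d c := fun a b c d ↦ by rw [h4, h3, h4]
  rw [h5, h5]
  linarith [h1 a c b d, h2 c a b d, h1 a d b c, h2 d a b c, h1 b c a d, h2 c b a d, h1 b d a c,
    h2 d b a c, h4 a d b c, h3 b c a d, h6 c b a d, h3 b d a c, h6 d b a c]

lemma riemann_cyclic (hG : IsMetricGerm G y) (a b c d : Fin 4) :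
    riemann G a b c d y + riemann G b c a d y + riemann G c a b d y = 0 := by
  obtain ⟨H, P, h1, h2, h3, h4, h5⟩ := hG.exists_riemann_eq
  rw [h5, h5, h5]
  have h6 : ∀ a b c d, P a b c d = P a b d c := fun a b c d ↦ by rw [h4, h3, h4]
  linarith [h1 a c b d, h2 a d b c, h1 b c a d, h2 b d a c, h1 a b c d, h2 c d a b, h6 a d b c,
    h6 b d a c, h6 c d a b]

lemma riemannUp_eq (hG : IsMetricGerm G y) (a b c d : Fin 4) :
    riemannUp G a b c d y = ∑ e, riemann G a b c e y * (G y)⁻¹ e d := by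
  have : ∀ v : Fin 4 → ℝ, Matrix.vecMul (Matrix.vecMul v (G y)) (G y)⁻¹ = v := fun v ↦ by
    rw [Matrix.vecMul_vecMul, hG.mul_inv, Matrix.vecMul_one]
  have := congrFun (this fun e ↦ riemannUp G a b c e y) d
  rw [← this]
  simp only [Matrix.vecMul, dotProduct, riemann]

lemma ricci_eq (hG : IsMetricGerm G y) (a b : Fin 4) :
    ricci G a b y = ∑ c, ∑ e, riemann G a c b e y * (G y)⁻¹ c e := by
  simp only [ricci, hG.riemannUp_eq]
  refine Finset.sum_congr rfl fun c _ ↦ Finset.sum_congr rfl fun e _ ↦ ?_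
  rw [hG.inv_symm]

lemma ricci_symm (hG : IsMetricGerm G y) (a b : Fin 4) : ricci G a b y = ricci G b a y := by
  rw [hG.ricci_eq, hG.ricci_eq, Finset.sum_comm]
  refine Finset.sum_congr rfl fun c _ ↦ Finset.sum_congr rfl fun e _ ↦ ?_
  rw [hG.inv_symm, hG.riemann_pair]

end IsMetricGerm

end CoordinateCurvature

/-! ### Passing from coordinates to an orthonormal frame -/

section FrameComponents

variable (E : Fin 4 → Fin 4 → ℝ)

/-- The components of a covariant four-tensor in the frame `E`. -/
def frameComp (T : Fin 4 → Fin 4 → Fin 4 → Fin 4 → ℝ) (i j k l : Fin 4) : ℝ :=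
  ∑ a, ∑ b, ∑ c, ∑ d, T a b c d * E i a * E j b * E k c * E l d

/-- The components of a covariant two-tensor in the frame `E`. -/
def frameComp₂ (X : Fin 4 → Fin 4 → ℝ) (i j : Fin 4) : ℝ := ∑ a, ∑ b, X a b * E i a * E j b

variable {E}

lemma frameComp_swap_left (T : Fin 4 → Fin 4 → Fin 4 → Fin 4 → ℝ) (i j k l : Fin 4) :
    frameComp E (fun a b c d ↦ T b a c d) i j k l = frameComp E T j i k l := by
  rw [frameComp, Finset.sum_comm]
  exact Finset.sum_congr rfl fun a _ ↦ Finset.sum_congr rfl fun b _ ↦ Finset.sum_congr rfl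
    fun c _ ↦ Finset.sum_congr rfl fun d _ ↦ by ring

lemma frameComp_swap_mid (T : Fin 4 → Fin 4 → Fin 4 → Fin 4 → ℝ) (i j k l : Fin 4) :
    frameComp E (fun a b c d ↦ T a c b d) i j k l = frameComp E T i k j l := by
  refine Finset.sum_congr rfl fun a _ ↦ ?_
  rw [Finset.sum_comm]
  exact Finset.sum_congr rfl fun b _ ↦ Finset.sum_congr rfl
    fun c _ ↦ Finset.sum_congr rfl fun d _ ↦ by ring

lemma frameComp_swap_right (T : Fin 4 → Fin 4 → Fin 4 → Fin 4 → ℝ) (i j k l : Fin 4) :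
    frameComp E (fun a b c d ↦ T a b d c) i j k l = frameComp E T i j l k := by
  refine Finset.sum_congr rfl fun a _ ↦ Finset.sum_congr rfl fun b _ ↦ ?_
  rw [Finset.sum_comm]
  exact Finset.sum_congr rfl fun c _ ↦ Finset.sum_congr rfl fun d _ ↦ by ring

lemma frameComp_add (T T' : Fin 4 → Fin 4 → Fin 4 → Fin 4 → ℝ) (i j k l : Fin 4) :
    frameComp E (fun a b c d ↦ T a b c d + T' a b c d) i j k l
      = frameComp E T i j k l + frameComp E T' i j k l := by
  simp only [frameComp, ← Finset.sum_add_distrib, add_mul]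

lemma frameComp_const_mul (x : ℝ) (T : Fin 4 → Fin 4 → Fin 4 → Fin 4 → ℝ) (i j k l : Fin 4) :
    frameComp E (fun a b c d ↦ x * T a b c d) i j k l = x * frameComp E T i j k l := by
  simp only [frameComp, Finset.mul_sum, mul_assoc]

lemma frameComp_neg (T : Fin 4 → Fin 4 → Fin 4 → Fin 4 → ℝ) (i j k l : Fin 4) :
    frameComp E (fun a b c d ↦ -T a b c d) i j k l = -frameComp E T i j k l := by
  simp only [frameComp, neg_mul, Finset.sum_neg_distrib]

lemma frameComp_sub (T T' : Fin 4 → Fin 4 → Fin 4 → Fin 4 → ℝ) (i j k l : Fin 4) :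
    frameComp E (fun a b c d ↦ T a b c d - T' a b c d) i j k l
      = frameComp E T i j k l - frameComp E T' i j k l := by
  simp only [frameComp, ← Finset.sum_sub_distrib, sub_mul]

lemma frameComp_mul (X Y : Fin 4 → Fin 4 → ℝ) (i j k l : Fin 4) :
    frameComp E (fun a b c d ↦ X a b * Y c d) i j k l
      = frameComp₂ E X i j * frameComp₂ E Y k l := by
  rw [frameComp, frameComp₂, frameComp₂, Finset.sum_mul]
  refine Finset.sum_congr rfl fun a _ ↦ ?_
  rw [Finset.sum_mul]
  refine Finset.sum_congr rfl fun b _ ↦ ?_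
  rw [Finset.mul_sum]
  refine Finset.sum_congr rfl fun c _ ↦ ?_
  rw [Finset.mul_sum]
  exact Finset.sum_congr rfl fun d _ ↦ by ring

lemma frameComp_mul_mid (X Y : Fin 4 → Fin 4 → ℝ) (i j k l : Fin 4) :
    frameComp E (fun a b c d ↦ X a c * Y b d) i j k l
      = frameComp₂ E X i k * frameComp₂ E Y j l := by
  rw [frameComp_swap_mid (fun a b c d ↦ X a b * Y c d), frameComp_mul]

lemma frameComp_mul_outer (X Y : Fin 4 → Fin 4 → ℝ) (i j k l : Fin 4) :
    frameComp E (fun a b c d ↦ X a d * Y b c) i j k l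
      = frameComp₂ E X i l * frameComp₂ E Y j k := by
  rw [frameComp_swap_right (fun a b c d ↦ X a c * Y b d), frameComp_mul_mid]

lemma frameComp_kulkarniNomizu (X Y : Fin 4 → Fin 4 → ℝ) (i j k l : Fin 4) :
    frameComp E (fun a b c d ↦ X a c * Y b d - X a d * Y b c - X b c * Y a d + X b d * Y a c)
        i j k l
      = frameComp₂ E X i k * frameComp₂ E Y j l - frameComp₂ E X i l * frameComp₂ E Y j k
        - frameComp₂ E X j k * frameComp₂ E Y i l + frameComp₂ E X j l * frameComp₂ E Y i k := by
  rw [frameComp_add, frameComp_sub, frameComp_sub, frameComp_mul_mid, frameComp_mul_outer,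
    frameComp_swap_left (fun a b c d ↦ X a c * Y b d), frameComp_mul_mid,
    frameComp_swap_left (fun a b c d ↦ X a d * Y b c), frameComp_mul_outer]

lemma frameComp₂_symm {X : Fin 4 → Fin 4 → ℝ} (hX : ∀ a b, X a b = X b a) (i j : Fin 4) :
    frameComp₂ E X i j = frameComp₂ E X j i := by
  rw [frameComp₂, Finset.sum_comm]
  refine Finset.sum_congr rfl fun a _ ↦ Finset.sum_congr rfl fun b _ ↦ ?_
  rw [hX]
  ring

variable {G : E4 → Matrix (Fin 4) (Fin 4) ℝ} {y : E4}

lemma minkowski_mul_self : minkowski * minkowski = 1 := by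
  ext i j
  fin_cases i <;> fin_cases j <;> simp [minkowski]

lemma of_mul_mul_transpose_apply (X : Matrix (Fin 4) (Fin 4) ℝ) (i j : Fin 4) :
    (Matrix.of E * X * (Matrix.of E).transpose) i j = frameComp₂ E X i j := by
  unfold frameComp₂
  rw [Matrix.mul_apply, Finset.sum_comm]
  refine Finset.sum_congr rfl fun b _ ↦ ?_
  rw [Matrix.mul_apply, Finset.sum_mul]
  refine Finset.sum_congr rfl fun a _ ↦ ?_
  simp only [Matrix.transpose_apply, Matrix.of_apply]
  ring

/-- Inverting E G Eᵀ = η, with η² = 1, gives G⁻¹ = Eᵀ η E; traces over the frame thus become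
contractions with G⁻¹. -/
lemma frame_complete (hE : ∀ i j, frameComp₂ E (G y) i j = minkowski i j) (b d : Fin 4) :
    ∑ i, minkowski i i * E i b * E i d = (G y)⁻¹ b d := by
  set F : Matrix (Fin 4) (Fin 4) ℝ := Matrix.of E with hF
  have h : F * (G y * F.transpose * minkowski) = 1 := by
    have : F * G y * F.transpose = minkowski := by
      ext i j
      rw [hF, of_mul_mul_transpose_apply, hE]
    rw [← Matrix.mul_assoc, ← Matrix.mul_assoc, this, minkowski_mul_self]
  have h2 : G y * (F.transpose * minkowski * F) = 1 := by
    rw [← mul_eq_one_comm.mp h]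
    simp only [Matrix.mul_assoc]
  rw [Matrix.inv_eq_right_inv h2, Matrix.mul_apply]
  refine Finset.sum_congr rfl fun i _ ↦ ?_
  simp only [minkowski, Matrix.mul_diagonal, hF, Matrix.transpose_apply, Matrix.of_apply,
    Matrix.diagonal_apply_eq]
  ring

lemma frame_contract (hE : ∀ i j, frameComp₂ E (G y) i j = minkowski i j)
    (T : Fin 4 → Fin 4 → Fin 4 → Fin 4 → ℝ) (j l : Fin 4) :
    ∑ i, minkowski i i * frameComp E T j i l i
      = frameComp₂ E (fun a c ↦ ∑ b, ∑ d, T a b c d * (G y)⁻¹ b d) j l := by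
  simp only [← frame_complete hE, frameComp, frameComp₂, Finset.mul_sum, Finset.sum_mul]
  have h : ∀ i, ∑ a, ∑ b, ∑ c, ∑ d, minkowski i i * (T a b c d * E j a * E i b * E l c * E i d)
      = ∑ a, ∑ c, ∑ b, ∑ d, minkowski i i * (T a b c d * E j a * E i b * E l c * E i d) := fun i ↦
    Finset.sum_congr rfl fun a _ ↦ Finset.sum_comm
  simp only [h]
  rw [Finset.sum_comm]
  refine Finset.sum_congr rfl fun a _ ↦ ?_
  rw [Finset.sum_comm]
  refine Finset.sum_congr rfl fun c _ ↦ ?_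
  rw [Finset.sum_comm]
  refine Finset.sum_congr rfl fun b _ ↦ ?_
  rw [Finset.sum_comm]
  refine Finset.sum_congr rfl fun d _ ↦ Finset.sum_congr rfl fun i _ ↦ ?_
  ring

lemma frame_contract₂ (hE : ∀ i j, frameComp₂ E (G y) i j = minkowski i j)
    (X : Fin 4 → Fin 4 → ℝ) :
    ∑ i, minkowski i i * frameComp₂ E X i i = ∑ a, ∑ b, (G y)⁻¹ a b * X a b := by
  simp only [← frame_complete hE, frameComp₂, Finset.mul_sum, Finset.sum_mul]
  rw [Finset.sum_comm]
  refine Finset.sum_congr rfl fun a _ ↦ ?_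
  rw [Finset.sum_comm]
  refine Finset.sum_congr rfl fun b _ ↦ Finset.sum_congr rfl fun i _ ↦ ?_
  ring

namespace IsMetricGerm

lemma frameComp_weyl (hE : ∀ i j, frameComp₂ E (G y) i j = minkowski i j) (i j k l : Fin 4) :
    frameComp E (fun a b c d ↦ weyl G a b c d y) i j k l =
      frameComp E (fun a b c d ↦ riemann G a b c d y) i j k l
      - (1 / 2) * (minkowski i k * frameComp₂ E (fun a b ↦ ricci G a b y) j l
        - minkowski i l * frameComp₂ E (fun a b ↦ ricci G a b y) j k
        - minkowski j k * frameComp₂ E (fun a b ↦ ricci G a b y) i l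
        + minkowski j l * frameComp₂ E (fun a b ↦ ricci G a b y) i k)
      + (1 / 6) * scalarCurv G y * (minkowski i k * minkowski j l - minkowski i l * minkowski j k)
      := by
  simp only [weyl]
  rw [frameComp_add, frameComp_sub, frameComp_const_mul,
    frameComp_kulkarniNomizu (G y) (fun a b ↦ ricci G a b y), frameComp_const_mul, frameComp_sub,
    frameComp_mul_mid (G y) (G y), frameComp_mul_outer (G y) (G y)]
  simp only [hE]

lemma isAlgebraicWeyl (hG : IsMetricGerm G y)
    (hE : ∀ i j, frameComp₂ E (G y) i j = minkowski i j) :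
    IsAlgebraicWeyl (frameComp E fun a b c d ↦ weyl G a b c d y) := by
  have hη : ∀ i j, minkowski i j = minkowski j i := fun i j ↦ by
    fin_cases i <;> fin_cases j <;> simp [minkowski]
  set R := frameComp E fun a b c d ↦ riemann G a b c d y with hR
  set Ric := frameComp₂ E fun a b ↦ ricci G a b y with hRic
  have hRs : ∀ i j, Ric i j = Ric j i := frameComp₂_symm hG.ricci_symm
  have r1 : ∀ i j k l, R i j k l = -R j i k l := fun i j k l ↦ by
    rw [hR, ← frameComp_swap_left, ← frameComp_neg]
    simp only [← hG.riemann_antisymm_left]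
  have r2 : ∀ i j k l, R i j k l = -R i j l k := fun i j k l ↦ by
    rw [hR, ← frameComp_swap_right, ← frameComp_neg]
    simp only [← hG.riemann_antisymm_right]
  have r4 : ∀ i j k l, R i j k l + R j k i l + R k i j l = 0 := fun i j k l ↦ by
    have e1 : R j k i l = frameComp E (fun a b c d ↦ riemann G b c a d y) i j k l := by
      rw [hR, frameComp_swap_left (fun a b c d ↦ riemann G a c b d y),
        frameComp_swap_mid (fun a b c d ↦ riemann G a b c d y)]
    have e2 : R k i j l = frameComp E (fun a b c d ↦ riemann G c a b d y) i j k l := by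
      rw [hR, frameComp_swap_mid (fun a b c d ↦ riemann G b a c d y),
        frameComp_swap_left (fun a b c d ↦ riemann G a b c d y)]
    rw [e1, e2, hR, ← frameComp_add, ← frameComp_add]
    simp only [hG.riemann_cyclic]
    simp [frameComp]
  -- The octahedron argument: four cyclic identities combined with the two antisymmetries yield pair
  -- symmetry.
  have r3 : ∀ i j k l, R i j k l = R k l i j := fun i j k l ↦ by
    linarith [r4 i j k l, r4 j k l i, r4 k l i j, r4 l i j k, r1 i j k l, r1 j k i l, r1 k i j l,
      r1 k l i j, r2 i j k l, r2 j k i l, r2 k i j l, r2 k l i j, r1 l j k i, r2 l j k i,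
      r1 j k l i, r1 k l j i, r1 l i k j, r2 l i k j, r1 i k l j, r2 i k l j, r1 j l i k,
      r2 j l i k, r1 l i j k, r1 i j l k, r2 i j l k, r2 k l j i, r2 j k l i, r2 l i j k]
  have hc : ∀ j l, ∑ i, minkowski i i * R j i l i = Ric j l := fun j l ↦ by
    rw [hR, frame_contract hE, hRic]
    simp only [hG.ricci_eq]
  have hS : ∑ i, minkowski i i * Ric i i = scalarCurv G y := by
    rw [hRic, frame_contract₂ hE]
    rfl
  constructor
  · intro i j k l
    rw [frameComp_weyl hE, frameComp_weyl hE, ← hR, ← hRic, r1]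
    ring
  · intro i j k l
    rw [frameComp_weyl hE, frameComp_weyl hE, ← hR, ← hRic, r2]
    ring
  · intro i j k l
    rw [frameComp_weyl hE, frameComp_weyl hE, ← hR, ← hRic, r3, hη k i, hη k j, hη l i, hη l j,
      hRs l j, hRs l i, hRs k j, hRs k i]
    ring
  · intro i j k l
    rw [frameComp_weyl hE, frameComp_weyl hE, frameComp_weyl hE, ← hR, ← hRic, hη j i, hη k j,
      hη k i, hRs j i, hRs k j, hRs k i]
    linarith [r4 i j k l]
  · intro b d
    simp only [frameComp_weyl hE, ← hR, ← hRic]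
    have hbd := hc b d
    have h0 : ∀ i, R i b i d = R b i d i := fun i ↦ by rw [r1, r2, neg_neg]
    simp only [h0]
    rw [← hS]
    clear_value R Ric
    clear r1 r2 r3 r4 h0 hc hS
    simp only [Fin.sum_univ_four] at hbd ⊢
    fin_cases b <;> fin_cases d <;> simp [minkowski] at hbd ⊢ <;>
      linarith [hRs 0 1, hRs 0 2, hRs 0 3, hRs 1 2, hRs 1 3, hRs 2 3]

/-- A metric whose curvature is, up to terms containing the metric, that of a hypersurface has a
Weyl spinor with real invariants. -/
lemma im_invariants_eq_zero (hG : IsMetricGerm G y)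
    (hE : ∀ i j, frameComp₂ E (G y) i j = minkowski i j) {h θ : Fin 4 → Fin 4 → ℝ} {κ : ℝ}
    (hh : ∀ a b, h a b = h b a) (hθ : ∀ a b, θ a b = θ b a)
    (hR : ∀ a b c d, riemann G a b c d y = κ * (h a d * h b c - h b d * h a c) +
      (G y a c * θ b d - G y a d * θ b c - G y b c * θ a d + G y b d * θ a c)) :
    (invI (weylSpinor (frameComp E fun a b c d ↦ weyl G a b c d y))).im = 0 ∧
      (invJ (weylSpinor (frameComp E fun a b c d ↦ weyl G a b c d y))).im = 0 := by
  have hη : ∀ i j, minkowski i j = minkowski j i := fun i j ↦ by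
    fin_cases i <;> fin_cases j <;> simp [minkowski]
  -- The Ricci and scalar terms of the Weyl tensor are themselves products with the metric and are
  -- absorbed into θ. The coefficient is 1/12 rather than 1/6 because the product of the metric with
  -- itself counts each term twice.
  refine (hG.isAlgebraicWeyl hE).im_invariants_eq_zero (h := frameComp₂ E h) (κ := κ)
    (θ := fun i j ↦ frameComp₂ E θ i j - (1 / 2) * frameComp₂ E (fun a b ↦ ricci G a b y) i j
      + (1 / 12) * scalarCurv G y * minkowski i j)
    (frameComp₂_symm hh) (fun i j ↦ ?_) (fun i j k l ↦ ?_)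
  · rw [frameComp₂_symm hθ, frameComp₂_symm hG.ricci_symm, hη]
  · rw [frameComp_weyl hE]
    simp only [hR]
    rw [frameComp_add, frameComp_const_mul, frameComp_kulkarniNomizu (G y) θ, frameComp_sub,
      frameComp_mul_outer, frameComp_swap_left (fun a b c d ↦ h a d * h b c), frameComp_mul_outer]
    simp only [hE]
    ring

end IsMetricGerm

end FrameComponents

/-! ### Linear algebra of the normal space in the null cone -/

section LightCone

open Module in
/-- Normal components of second derivatives of an immersion of codimension three into a null cone:
apart from terms containing the metric they are spanned by a single vector. -/
lemma exists_normal_decomposition {V : Type*} [AddCommGroup V] [Module ℝ V] [FiniteDimensional ℝ V]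
    (hV : finrank ℝ V = 7) (B : LinearMap.BilinForm ℝ V) (hB : ∀ v w, B v w = B w v)
    {G : Matrix (Fin 4) (Fin 4) ℝ} (hG : G.det ≠ 0) {X : Fin 4 → V} {F : V}
    {Z : Fin 4 → Fin 4 → V} (hX : ∀ i j, B (X i) (X j) = G i j) (hFF : B F F = 0)
    (hFX : ∀ i, B F (X i) = 0) (hFZ : ∀ a b, B F (Z a b) = -G a b) (hZ : ∀ a b, Z a b = Z b a)
    (hF : ∃ L, B F L ≠ 0) :
    ∃ (κ : ℝ) (h θ : Fin 4 → Fin 4 → ℝ), (∀ a b, h a b = h b a) ∧ (∀ a b, θ a b = θ b a) ∧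
      ∀ a b c d, B (Z a b) (Z c d) - ∑ e, ∑ f, G⁻¹ e f * (B (X e) (Z a b) * B (X f) (Z c d))
        = κ * (h a b * h c d) - (G a b * θ c d + θ a b * G c d) := by
  have hGs : ∀ i j, G i j = G j i := fun i j ↦ by rw [← hX, hB, hX]
  have hGi : G * G⁻¹ = 1 := Matrix.mul_nonsing_inv _ (isUnit_iff_ne_zero.mpr hG)
  have hlow : ∀ (v : Fin 4 → ℝ) i, ∑ e, ∑ f, G⁻¹ e f * v f * G i e = v i := fun v i ↦ by
    have : G.mulVec (G⁻¹.mulVec v) i = v i := by rw [Matrix.mulVec_mulVec, hGi, Matrix.one_mulVec]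
    rw [← this]
    simp only [Matrix.mulVec, dotProduct, Finset.mul_sum]
    exact Finset.sum_congr rfl fun e _ ↦ Finset.sum_congr rfl fun f _ ↦ by ring
  -- the tangential vector with prescribed products with the `X i`
  set τ : (Fin 4 → ℝ) → V := fun v ↦ ∑ e, ∑ f, (G⁻¹ e f * v f) • X e with hτ
  have hXτ : ∀ v i, B (X i) (τ v) = v i := fun v i ↦ by
    simp only [hτ, map_sum, map_smul, smul_eq_mul, hX, hlow]
  have hFτ : ∀ v, B F (τ v) = 0 := fun v ↦ by
    simp [hτ, map_sum, map_smul, hFX]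
  have hτB : ∀ v w, B (τ v) w = ∑ e, ∑ f, G⁻¹ e f * (B (X e) w * v f) := fun v w ↦ by
    simp only [hτ, map_sum, map_smul, LinearMap.sum_apply, LinearMap.smul_apply, smul_eq_mul]
    exact Finset.sum_congr rfl fun e _ ↦ Finset.sum_congr rfl fun f _ ↦ by ring
  set π : V → V := fun v ↦ v - τ fun i ↦ B (X i) v with hπ
  have hXπ : ∀ i v, B (X i) (π v) = 0 := fun i v ↦ by simp [hπ, hXτ]
  have hFπ : ∀ v, B F (π v) = B F v := fun v ↦ by simp [hπ, hFτ]
  have hππ : ∀ v w, B (π v) (π w)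
      = B w v - ∑ e, ∑ f, G⁻¹ e f * (B (X e) w * B (X f) v) := fun v w ↦ by
    have h1 : B (τ fun i ↦ B (X i) w) (π v) = 0 := by simp [hτB, hXπ]
    rw [hB (π v)]
    conv_lhs => rw [hπ]
    simp only [map_sub, LinearMap.sub_apply]
    simp only [map_sub, hπ] at h1
    have h2 : B w (τ fun i ↦ B (X i) v) = ∑ e, ∑ f, G⁻¹ e f * (B (X e) w * B (X f) v) := by
      rw [hB, hτB]
    linarith
  obtain ⟨L₀, hL₀⟩ := hF
  -- Removing the tangential part of L₀ does not change its product with F, as F is orthogonal to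
  -- all X i.
  set L := (B F L₀)⁻¹ • π L₀ with hL
  have hXL : ∀ i, B (X i) L = 0 := fun i ↦ by simp [hL, hXπ]
  have hFL : B F L = 1 := by simp [hL, hFπ, hL₀]
  set φ : V →ₗ[ℝ] (Fin 4 → ℝ) × ℝ × ℝ :=
    (LinearMap.pi fun i ↦ B (X i)).prod ((B F).prod (B L)) with hφ
  have hsurj : Function.Surjective φ := by
    rintro ⟨v, p, q⟩
    -- L is not assumed null; the coefficient of F compensates for B L L.
    refine ⟨τ v + p • L + (q - p * B L L) • F, ?_⟩
    have hLτ : B L (τ v) = 0 := by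
      rw [hB, hτB]; simp [hXL]
    have hXF : ∀ i, B (X i) F = 0 := fun i ↦ by rw [hB, hFX]
    have hLF : B L F = 1 := by rw [hB, hFL]
    refine Prod.ext (funext fun i ↦ ?_) (Prod.ext ?_ ?_) <;>
      simp [hφ, hXτ, hXL, hXF, hFτ, hFL, hFF, hLτ, hLF]
  have hker : finrank ℝ (LinearMap.ker φ) = 1 := by
    have h1 := LinearMap.finrank_range_add_finrank_ker φ
    rw [LinearMap.range_eq_top.mpr hsurj, finrank_top, hV] at h1
    simp at h1
    omega
  obtain ⟨n, -, hn⟩ := finrank_eq_one_iff'.mp hker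
  -- The coefficient is made a function on all of V (0 off the kernel), so that symmetry of W in a,
  -- b passes directly to the form h.
  have hn' : ∀ v : V, ∃ c : ℝ, v ∈ LinearMap.ker φ → c • (n : V) = v := fun v ↦ by
    by_cases hv : v ∈ LinearMap.ker φ
    · obtain ⟨c, hc⟩ := hn ⟨v, hv⟩
      exact ⟨c, fun _ ↦ congrArg Subtype.val hc⟩
    · exact ⟨0, fun h ↦ absurd h hv⟩
  choose c hc using hn'
  have hnφ : φ n = 0 := n.2
  have hFn : B F n = 0 := congrArg (fun x ↦ x.2.1) hnφ
  have hLn : B L n = 0 := congrArg (fun x ↦ x.2.2) hnφ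
  set β : Fin 4 → Fin 4 → ℝ := fun a b ↦ B L (π (Z a b)) + G a b * B L L with hβ
  -- The normal part of Z with its L and F components removed: the product with F fixes the L
  -- coefficient as -G, and β then cancels the product with L.
  set W : Fin 4 → Fin 4 → V := fun a b ↦ π (Z a b) + G a b • L - β a b • F with hW
  have hWker : ∀ a b, W a b ∈ LinearMap.ker φ := fun a b ↦ by
    have hXF : ∀ i, B (X i) F = 0 := fun i ↦ by rw [hB, hFX]
    have hLF : B L F = 1 := by rw [hB, hFL]
    rw [LinearMap.mem_ker]
    refine Prod.ext (funext fun i ↦ ?_) (Prod.ext ?_ ?_) <;>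
      simp [hφ, hW, hXπ, hXL, hXF, hFπ, hFZ, hFL, hFF, hLF, hβ]
  have hWn : ∀ a b, c (W a b) • (n : V) = W a b := fun a b ↦ hc _ (hWker a b)
  have hβs : ∀ a b, β a b = β b a := fun a b ↦ by simp only [hβ, hZ a b, hGs a b]
  have hπZ : ∀ a b, π (Z a b) = c (W a b) • (n : V) + β a b • F - G a b • L := fun a b ↦ by
    rw [hWn]
    simp only [hW]
    abel
  -- Expanding the product of two vectors c n + βF - G L leaves the n-term, -Gβ - βG, and B L L
  -- times GG. Splitting the last term evenly between the two slots gives θ.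
  refine ⟨B n n, fun a b ↦ c (W a b), fun a b ↦ β a b - (1 / 2) * B L L * G a b, fun a b ↦ ?_,
    fun a b ↦ ?_, fun a b c' d ↦ ?_⟩
  · simp only [hW, hZ a b, hβs a b, hGs a b]
  · change β a b - _ * G a b = β b a - _ * G b a
    rw [hβs, hGs]
  · rw [← hππ, hπZ, hπZ]
    have hnF : B n F = 0 := by rw [hB, hFn]
    have hnL : B n L = 0 := by rw [hB, hLn]
    have hLF : B L F = 1 := by rw [hB, hFL]
    simp only [map_add, map_sub, map_smul, LinearMap.add_apply, LinearMap.sub_apply,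
      LinearMap.smul_apply, smul_eq_mul, hFF, hFL, hFn, hLn, hnF, hnL, hLF]
    ring

end LightCone

/-! ### The Gauss equation and the lift to the null cone -/

section Immersion

variable {K : Type*} [Fintype K]

/-- The diagonal bilinear form `∑ s_k v_k w_k`. -/
def diagForm (s : K → ℝ) : LinearMap.BilinForm ℝ (K → ℝ) :=
  LinearMap.mk₂ ℝ (fun v w ↦ ∑ k, s k * v k * w k)
    (fun v v' w ↦ by simp only [Pi.add_apply, mul_add, add_mul, Finset.sum_add_distrib])
    (fun x v w ↦ by
      simp only [Pi.smul_apply, smul_eq_mul, Finset.mul_sum]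
      exact Finset.sum_congr rfl fun k _ ↦ by ring)
    (fun v w w' ↦ by simp only [Pi.add_apply, mul_add, Finset.sum_add_distrib])
    (fun x v w ↦ by
      simp only [Pi.smul_apply, smul_eq_mul, Finset.mul_sum]
      exact Finset.sum_congr rfl fun k _ ↦ by ring)

lemma diagForm_apply (s v w : K → ℝ) : diagForm s v w = ∑ k, s k * v k * w k := rfl

lemma diagForm_comm (s v w : K → ℝ) : diagForm s v w = diagForm s w v := by
  simp only [diagForm_apply]
  exact Finset.sum_congr rfl fun k _ ↦ by ring

lemma pd_diagForm (s : K → ℝ) {v w : E4 → K → ℝ} {y : E4}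
    (hv : ∀ k, DifferentiableAt ℝ (fun z ↦ v z k) y)
    (hw : ∀ k, DifferentiableAt ℝ (fun z ↦ w z k) y) (i : Fin 4) :
    pd i (fun z ↦ diagForm s (v z) (w z)) y
      = diagForm s (fun k ↦ pd i (fun z ↦ v z k) y) (w y)
        + diagForm s (v y) (fun k ↦ pd i (fun z ↦ w z k) y) := by
  simp only [diagForm_apply]
  rw [pd_sum (f := fun k z ↦ s k * v z k * w z k) fun k _ ↦ ((hv k).const_mul _).mul (hw k),
    ← Finset.sum_add_distrib]
  refine Finset.sum_congr rfl fun k _ ↦ ?_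
  rw [pd_mul ((hv k).const_mul _) (hw k), pd_const_mul (hv k)]
  ring

/-- First derivatives of a map into `ℝ^K`. -/
def tangentVec (F : K → E4 → ℝ) (i : Fin 4) (z : E4) : K → ℝ := fun k ↦ pd i (F k) z

/-- Second derivatives of a map into `ℝ^K`. -/
def secondDeriv (F : K → E4 → ℝ) (i j : Fin 4) (z : E4) : K → ℝ := fun k ↦ pd i (pd j (F k)) z

variable {s : K → ℝ} {F : K → E4 → ℝ} {G : E4 → Matrix (Fin 4) (Fin 4) ℝ} {y : E4}

lemma secondDeriv_comm {K : Type*} {F : K → E4 → ℝ} (hF : ∀ k, ContDiffAt ℝ 4 (F k) y) (i j : Fin 4) :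
    secondDeriv F i j y = secondDeriv F j i y :=
  funext fun k ↦ pd_comm ((hF k).of_le (by norm_num)) i j

lemma eventually_contDiffAt (hF : ∀ k, ContDiffAt ℝ 4 (F k) y) :
    ∀ᶠ z in 𝓝 y, ∀ k, ContDiffAt ℝ 4 (F k) z := by
  rw [Filter.eventually_all]
  exact fun k ↦ (hF k).eventually (by norm_num)

lemma pd_tangentVec_form (hF : ∀ k, ContDiffAt ℝ 4 (F k) y) (a i j : Fin 4) :
    pd a (fun z ↦ diagForm s (tangentVec F i z) (tangentVec F j z)) y
      = diagForm s (secondDeriv F a i y) (tangentVec F j y)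
        + diagForm s (tangentVec F i y) (secondDeriv F a j y) := by
  have h : ∀ i k, DifferentiableAt ℝ (fun z ↦ tangentVec F i z k) y := fun i k ↦
    (contDiffAt_pd (m := 3) (hF k) (by norm_num) i).differentiableAt (by norm_num)
  exact pd_diagForm s (h i) (h j) a

lemma christoffelLow_of_immersion (hF : ∀ k, ContDiffAt ℝ 4 (F k) y)
    (hG : ∀ᶠ z in 𝓝 y, ∀ i j, G z i j = diagForm s (tangentVec F i z) (tangentVec F j z))
    (d a b : Fin 4) :
    christoffelLow G d a b y = diagForm s (tangentVec F d y) (secondDeriv F a b y) := by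
  have h : ∀ a i j, pd a (fun z ↦ G z i j) y
      = diagForm s (secondDeriv F a i y) (tangentVec F j y)
        + diagForm s (tangentVec F i y) (secondDeriv F a j y) := fun a i j ↦ by
    rw [pd_congr (hG.mono fun z hz ↦ hz i j), pd_tangentVec_form hF]
  rw [christoffelLow, h, h, h, secondDeriv_comm hF a d, secondDeriv_comm hF b d,
    secondDeriv_comm hF b a, diagForm_comm s (tangentVec F a y) (secondDeriv F d b y),
    diagForm_comm s (secondDeriv F a b y)]
  ring

/-- The first-kind symbols are ⟨X_d, Z_ab⟩. Their derivatives contain third derivatives of F, which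
drop out of the antisymmetrised expression because partial derivatives commute; the quadratic terms
subtract the tangential parts. -/
lemma riemann_of_immersion (hM : IsMetricGerm G y) (hF : ∀ k, ContDiffAt ℝ 4 (F k) y)
    (hG : ∀ᶠ z in 𝓝 y, ∀ i j, G z i j = diagForm s (tangentVec F i z) (tangentVec F j z))
    (a b c d : Fin 4) :
    riemann G a b c d y =
      (diagForm s (secondDeriv F a d y) (secondDeriv F b c y)
        - ∑ e, ∑ f, (G y)⁻¹ e f * (diagForm s (tangentVec F e y) (secondDeriv F a d y)
          * diagForm s (tangentVec F f y) (secondDeriv F b c y)))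
      - (diagForm s (secondDeriv F b d y) (secondDeriv F a c y)
        - ∑ e, ∑ f, (G y)⁻¹ e f * (diagForm s (tangentVec F e y) (secondDeriv F b d y)
          * diagForm s (tangentVec F f y) (secondDeriv F a c y))) := by
  have hev : ∀ d a b, christoffelLow G d a b
      =ᶠ[𝓝 y] fun z ↦ diagForm s (tangentVec F d z) (secondDeriv F a b z) := fun d a b ↦ by
    filter_upwards [eventually_contDiffAt hF, hG.eventually_nhds] with z h1 h2
    exact christoffelLow_of_immersion h1 h2 d a b
  have h1 : ∀ i k, DifferentiableAt ℝ (fun z ↦ tangentVec F i z k) y := fun i k ↦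
    (contDiffAt_pd (m := 3) (hF k) (by norm_num) i).differentiableAt (by norm_num)
  have h2 : ∀ i j k, DifferentiableAt ℝ (fun z ↦ secondDeriv F i j z k) y := fun i j k ↦
    (contDiffAt_pd (m := 2) (contDiffAt_pd (m := 3) (hF k) (by norm_num) j)
      (by norm_num) i).differentiableAt (by norm_num)
  have h3 : ∀ k, pd a (pd b (pd c (F k))) y = pd b (pd a (pd c (F k))) y := fun k ↦
    pd_comm (contDiffAt_pd (m := 2) (hF k) (by norm_num) c) a b
  have h4 : pd a (christoffelLow G d b c) y
      = diagForm s (secondDeriv F a d y) (secondDeriv F b c y)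
        + diagForm s (tangentVec F d y) (fun k ↦ pd a (pd b (pd c (F k))) y) := by
    rw [pd_congr (hev d b c)]
    exact pd_diagForm s (h1 d) (h2 b c) a
  have h5 : pd b (christoffelLow G d a c) y
      = diagForm s (secondDeriv F b d y) (secondDeriv F a c y)
        + diagForm s (tangentVec F d y) (fun k ↦ pd b (pd a (pd c (F k))) y) := by
    rw [pd_congr (hev d a c)]
    exact pd_diagForm s (h1 d) (h2 a c) b
  rw [hM.riemann_eq, h4, h5]
  simp only [(hev _ _ _).self_of_nhds, h3]
  ring

/-- The curvature of a metric induced on a submanifold of codimension three of a null cone. -/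
lemma exists_riemann_of_null_immersion (hK : Fintype.card K = 7) (hM : IsMetricGerm G y)
    (hF : ∀ k, ContDiffAt ℝ 4 (F k) y)
    (hG : ∀ᶠ z in 𝓝 y, ∀ i j, G z i j = diagForm s (tangentVec F i z) (tangentVec F j z))
    (hnull : ∀ z, diagForm s (fun k ↦ F k z) (fun k ↦ F k z) = 0)
    (hF0 : ∃ L, diagForm s (fun k ↦ F k y) L ≠ 0) :
    ∃ (κ : ℝ) (h θ : Fin 4 → Fin 4 → ℝ), (∀ a b, h a b = h b a) ∧ (∀ a b, θ a b = θ b a) ∧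
      ∀ a b c d, riemann G a b c d y = κ * (h a d * h b c - h b d * h a c) +
        (G y a c * θ b d - G y a d * θ b c - G y b c * θ a d + G y b d * θ a c) := by
  have hd0 : ∀ᶠ z in 𝓝 y, ∀ k, DifferentiableAt ℝ (F k) z :=
    (eventually_contDiffAt hF).mono fun z hz k ↦ (hz k).differentiableAt (by norm_num)
  have h1 : ∀ i k, DifferentiableAt ℝ (fun z ↦ tangentVec F i z k) y := fun i k ↦
    (contDiffAt_pd (m := 3) (hF k) (by norm_num) i).differentiableAt (by norm_num)
  -- One derivative of ⟨F, F⟩ = 0 gives ⟨F, X⟩ = 0 near y; a second gives ⟨F, Z⟩ = -G.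
  have horth : ∀ i, ∀ᶠ z in 𝓝 y, diagForm s (fun k ↦ F k z) (tangentVec F i z) = 0 := by
    intro i
    filter_upwards [hd0] with z hz
    have e1 := pd_diagForm s (v := fun z k ↦ F k z) (w := fun z k ↦ F k z) hz hz i
    have e2 : pd i (fun z ↦ diagForm s (fun k ↦ F k z) (fun k ↦ F k z)) z = 0 := by
      simp only [hnull]
      simp [pd]
    rw [e2, diagForm_comm] at e1
    change 0 = diagForm s (fun k ↦ F k z) (tangentVec F i z)
      + diagForm s (fun k ↦ F k z) (tangentVec F i z) at e1
    linarith
  have hFZ : ∀ a b, diagForm s (fun k ↦ F k y) (secondDeriv F a b y) = -G y a b := by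
    intro a b
    have e1 := pd_diagForm s (v := fun z k ↦ F k z) (w := tangentVec F b) hd0.self_of_nhds (h1 b) a
    have e2 : pd a (fun z ↦ diagForm s (fun k ↦ F k z) (tangentVec F b z)) y = 0 := by
      rw [pd_congr (g := fun _ ↦ 0) (horth b)]
      simp [pd]
    rw [e2] at e1
    change 0 = diagForm s (tangentVec F a y) (tangentVec F b y)
      + diagForm s (fun k ↦ F k y) (secondDeriv F a b y) at e1
    rw [hG.self_of_nhds]
    linarith
  obtain ⟨κ, h, θ, hh, hθ, hd⟩ := exists_normal_decomposition (V := K → ℝ) (by simp [hK])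
    (diagForm s) (diagForm_comm s) hM.det_ne_zero (X := fun i ↦ tangentVec F i y)
    (F := fun k ↦ F k y) (Z := fun a b ↦ secondDeriv F a b y)
    (fun i j ↦ (hG.self_of_nhds i j).symm) (hnull y) (fun i ↦ (horth i).self_of_nhds) hFZ
    (secondDeriv_comm hF) hF0
  refine ⟨κ, h, θ, hh, hθ, fun a b c d ↦ ?_⟩
  rw [riemann_of_immersion hM hF hG, hd, hd]
  ring

/-- The lift of a map `u` into a flat space, rescaled by `f`, to the null cone of a flat space with
two more dimensions. -/
def coneLift (s : K → ℝ) (u : K → E4 → ℝ) (f : E4 → ℝ) : K ⊕ Fin 2 → E4 → ℝ :=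
  Sum.elim (fun k z ↦ f z * u k z)
    ![fun z ↦ (1 / 2) * (f z * (1 - ∑ k, s k * (u k z * u k z))),
      fun z ↦ (1 / 2) * (f z * (1 + ∑ k, s k * (u k z * u k z)))]

lemma contDiffAt_coneLift {n : WithTop ℕ∞} {u : K → E4 → ℝ} {f : E4 → ℝ}
    (hu : ∀ k, ContDiffAt ℝ n (u k) y) (hf : ContDiffAt ℝ n f y) (k : K ⊕ Fin 2) :
    ContDiffAt ℝ n (coneLift s u f k) y := by
  have hQ : ContDiffAt ℝ n (fun z ↦ ∑ k, s k * (u k z * u k z)) y :=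
    ContDiffAt.sum fun k _ ↦ contDiffAt_const.mul ((hu k).mul (hu k))
  rcases k with k | k
  · exact hf.mul (hu k)
  · fin_cases k
    · exact contDiffAt_const.mul (hf.mul (contDiffAt_const.sub hQ))
    · exact contDiffAt_const.mul (hf.mul (contDiffAt_const.add hQ))

/-- With Q = ⟨u, u⟩, the two extra coordinates contribute ((1 - Q)² - (1 + Q)²)/4 = -Q. -/
lemma coneLift_null (s : K → ℝ) (u : K → E4 → ℝ) (f : E4 → ℝ) (z : E4) :
    diagForm (Sum.elim s ![1, -1]) (fun k ↦ coneLift s u f k z) (fun k ↦ coneLift s u f k z)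
      = 0 := by
  simp only [diagForm_apply, Fintype.sum_sum_type, coneLift, Sum.elim_inl, Sum.elim_inr,
    Fin.sum_univ_two]
  have : ∑ k, s k * (f z * u k z) * (f z * u k z) = f z ^ 2 * ∑ k, s k * (u k z * u k z) := by
    rw [Finset.mul_sum]
    exact Finset.sum_congr rfl fun k _ ↦ by ring
  rw [this]
  simp
  ring

/-- Derivatives of f multiply the unscaled lift, which is null and orthogonal to its own
derivatives, so they drop out; the unscaled lift induces the same form as u. -/
lemma coneLift_induced {u : K → E4 → ℝ} {f : E4 → ℝ} (hu : ∀ k, DifferentiableAt ℝ (u k) y)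
    (hf : DifferentiableAt ℝ f y) (i j : Fin 4) :
    diagForm (Sum.elim s ![1, -1]) (tangentVec (coneLift s u f) i y)
        (tangentVec (coneLift s u f) j y)
      = f y ^ 2 * ∑ k, s k * pd i (u k) y * pd j (u k) y := by
  set Q : E4 → ℝ := fun z ↦ ∑ k, s k * (u k z * u k z) with hQ
  have hQd : DifferentiableAt ℝ Q y :=
    DifferentiableAt.fun_sum fun k _ ↦ ((hu k).mul (hu k)).const_mul (s k)
  have hQi : ∀ i, pd i Q y = 2 * ∑ k, s k * (u k y * pd i (u k) y) := fun i ↦ by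
    rw [hQ, pd_sum (f := fun k z ↦ s k * (u k z * u k z))
      fun k _ ↦ ((hu k).mul (hu k)).const_mul (s k), Finset.mul_sum]
    refine Finset.sum_congr rfl fun k _ ↦ ?_
    rw [pd_const_mul (f := fun z ↦ u k z * u k z) ((hu k).mul (hu k)), pd_mul (hu k) (hu k)]
    ring
  have hl : ∀ i k, tangentVec (coneLift s u f) i y (Sum.inl k)
      = f y * pd i (u k) y + pd i f y * u k y := fun i k ↦ pd_mul hf (hu k) i
  have h0 : ∀ i, tangentVec (coneLift s u f) i y (Sum.inr 0)
      = (1 / 2) * (pd i f y * (1 - Q y) - f y * pd i Q y) := fun i ↦ by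
    have e1 := pd_const_mul (hf.mul ((differentiableAt_const (1 : ℝ)).sub hQd)) (1 / 2) i
    have e2 := pd_mul hf ((differentiableAt_const (1 : ℝ)).sub hQd) i
    have e3 := pd_sub (differentiableAt_const (1 : ℝ)) hQd i
    have e4 : pd i (fun _ ↦ (1 : ℝ)) y = 0 := by simp [pd]
    refine e1.trans ?_
    refine (congrArg _ e2).trans ?_
    refine (congrArg (fun x ↦ 1 / 2 * (f y * x + _)) e3).trans ?_
    rw [e4]
    simp only [Pi.sub_apply]
    ring
  have h1 : ∀ i, tangentVec (coneLift s u f) i y (Sum.inr 1)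
      = (1 / 2) * (pd i f y * (1 + Q y) + f y * pd i Q y) := fun i ↦ by
    have e1 := pd_const_mul (hf.mul ((differentiableAt_const (1 : ℝ)).add hQd)) (1 / 2) i
    have e2 := pd_mul hf ((differentiableAt_const (1 : ℝ)).add hQd) i
    have e3 := pd_add (differentiableAt_const (1 : ℝ)) hQd i
    have e4 : pd i (fun _ ↦ (1 : ℝ)) y = 0 := by simp [pd]
    refine e1.trans ?_
    refine (congrArg _ e2).trans ?_
    refine (congrArg (fun x ↦ 1 / 2 * (f y * x + _)) e3).trans ?_
    rw [e4]
    simp only [Pi.add_apply]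
    ring
  simp only [diagForm_apply, Fintype.sum_sum_type, Fin.sum_univ_two, hl, h0, h1, Sum.elim_inl,
    Sum.elim_inr]
  have hsum : ∑ k, s k * (f y * pd i (u k) y + pd i f y * u k y)
        * (f y * pd j (u k) y + pd j f y * u k y)
      = f y ^ 2 * (∑ k, s k * pd i (u k) y * pd j (u k) y)
        + f y * pd j f y * (pd i Q y / 2) + f y * pd i f y * (pd j Q y / 2)
        + pd i f y * pd j f y * Q y := by
    rw [hQi, hQi, hQ]
    simp only [Finset.mul_sum, Finset.sum_div, ← Finset.sum_add_distrib]
    exact Finset.sum_congr rfl fun k _ ↦ by ring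
  rw [hsum]
  simp
  ring

/-- The curvature of a metric conformal to that of a hypersurface of a flat space. -/
lemma exists_riemann_of_conformal_immersion (hK : Fintype.card K = 5) (hM : IsMetricGerm G y)
    {u : K → E4 → ℝ} {f : E4 → ℝ} (hu : ∀ k, ContDiffAt ℝ 4 (u k) y) (hf : ContDiffAt ℝ 4 f y)
    (hfy : f y ≠ 0)
    (hG : ∀ᶠ z in 𝓝 y, ∀ i j, G z i j = f z ^ 2 * ∑ k, s k * pd i (u k) z * pd j (u k) z) :
    ∃ (κ : ℝ) (h θ : Fin 4 → Fin 4 → ℝ), (∀ a b, h a b = h b a) ∧ (∀ a b, θ a b = θ b a) ∧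
      ∀ a b c d, riemann G a b c d y = κ * (h a d * h b c - h b d * h a c) +
        (G y a c * θ b d - G y a d * θ b c - G y b c * θ a d + G y b d * θ a c) := by
  refine exists_riemann_of_null_immersion (s := Sum.elim s ![1, -1]) (F := coneLift s u f)
    (by simp [hK]) hM (contDiffAt_coneLift hu hf) ?_ (coneLift_null s u f) ?_
  · filter_upwards [hG, eventually_contDiffAt hu, hf.eventually (by norm_num)] with z h1 h2 h3 i j
    rw [h1, coneLift_induced (fun k ↦ (h2 k).differentiableAt (by norm_num))
      (h3.differentiableAt (by norm_num))]
  -- The product of the lift with this vector is the sum of its last two coordinates, namely f.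
  · refine ⟨Sum.elim 0 ![1, -1], ?_⟩
    simp only [diagForm_apply, Fintype.sum_sum_type, coneLift, Sum.elim_inl, Sum.elim_inr,
      Fin.sum_univ_two]
    simp
    ring_nf
    exact hfy

end Immersion

/-! ### Back to the manifold -/

namespace LorentzMetric

variable {M : Type*} [TopologicalSpace M] [ChartedSpace E4 M] [IsManifold (𝓡 4) ∞ M]
  (g : LorentzMetric M)

lemma mdifferentiableAt_chart_symm {p : M} {z : E4} (hz : z ∈ (extChartAt (𝓡 4) p).target) :
    MDifferentiableAt 𝓘(ℝ, E4) (𝓡 4) (extChartAt (𝓡 4) p).symm z :=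
  ((contMDiffOn_extChartAt_symm (n := ∞) p).contMDiffAt
    ((isOpen_extChartAt_target p).mem_nhds hz)).mdifferentiableAt (by simp)

/-- The coordinate field is the tangent map of the inverse chart applied to a constant section,
hence smooth as a map into the tangent bundle. -/
lemma contMDiffAt_chart_frame {p : M} {z : E4} (hz : z ∈ (extChartAt (𝓡 4) p).target) (v : E4) :
    ContMDiffAt 𝓘(ℝ, E4) (𝓡 4).tangent ∞
      (fun x ↦ (⟨(extChartAt (𝓡 4) p).symm x,
        mfderiv 𝓘(ℝ, E4) (𝓡 4) (extChartAt (𝓡 4) p).symm x v⟩ : TangentBundle (𝓡 4) M)) z := by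
  have hT := isOpen_extChartAt_target (I := 𝓡 4) p
  have h1 := (contMDiffOn_extChartAt_symm (I := 𝓡 4) (n := ∞) p).contMDiffOn_tangentMapWithin
    (m := ∞) (by simp) hT.uniqueMDiffOn
  have h2 : ContMDiffAt 𝓘(ℝ, E4) 𝓘(ℝ, E4).tangent ∞
      (fun x ↦ (⟨x, v⟩ : TangentBundle 𝓘(ℝ, E4) E4)) z :=
    contMDiffAt_vectorSpace_iff_contDiffAt.mpr contDiffAt_const
  have h3 := (h1.contMDiffAt (x := ⟨z, v⟩) ((hT.preimage
    (FiberBundle.continuous_proj E4 (TangentSpace 𝓘(ℝ, E4)))).mem_nhds hz)).comp z h2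
  refine h3.congr_of_eventuallyEq ?_
  filter_upwards [hT.mem_nhds hz] with x hx
  simp only [Function.comp_apply, tangentMapWithin]
  rw [mfderivWithin_of_isOpen hT hx]

lemma contDiffAt_chartMetric {p : M} {z : E4} (hz : z ∈ (extChartAt (𝓡 4) p).target)
    (i j : Fin 4) : ContDiffAt ℝ ∞ (fun x ↦ g.chartMetric p x i j) z := by
  have hφ : ContMDiffAt 𝓘(ℝ, E4) (𝓡 4) ∞ (extChartAt (𝓡 4) p).symm z :=
    (contMDiffOn_extChartAt_symm (n := ∞) p).contMDiffAt
      ((isOpen_extChartAt_target p).mem_nhds hz)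
  have h : ContMDiffAt 𝓘(ℝ, E4) ((𝓡 4).prod 𝓘(ℝ)) ∞
      (fun x ↦ Bundle.TotalSpace.mk' ℝ (E := Bundle.Trivial M ℝ) ((extChartAt (𝓡 4) p).symm x)
        (g.chartMetric p x i j)) z := by
    apply ContMDiffAt.clm_bundle_apply₂ (F₁ := E4) (F₂ := E4)
    · exact g.contMDiff.contMDiffAt.comp z hφ
    · exact contMDiffAt_chart_frame hz _
    · exact contMDiffAt_chart_frame hz _
  rw [Bundle.contMDiffAt_totalSpace] at h
  exact h.2.contDiffAt

lemma chartMetric_symm (p : M) (z : E4) : (g.chartMetric p z).transpose = g.chartMetric p z := by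
  ext i j
  exact g.symm _ _ _

lemma mfderiv_chart_symm_coords (p : M) (v : TangentSpace (𝓡 4) p) :
    mfderiv 𝓘(ℝ, E4) (𝓡 4) (extChartAt (𝓡 4) p).symm (extChartAt (𝓡 4) p p) (coords p v) = v := by
  have h := mfderivWithin_extChartAt_symm_comp_mfderiv_extChartAt' (I := 𝓡 4) (x := p)
    (mem_extChartAt_source p)
  rw [ModelWithCorners.range_eq_univ, mfderivWithin_univ] at h
  exact congrArg (fun L : E4 →L[ℝ] E4 ↦ L v) h

lemma frameComp₂_chartMetric (p : M) (e : Fin 4 → TangentSpace (𝓡 4) p) (i j : Fin 4) :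
    frameComp₂ (fun i a ↦ coords p (e i) a) (g.chartMetric p (extChartAt (𝓡 4) p p)) i j
      = g.inner p (e i) (e j) := by
  set q := (extChartAt (𝓡 4) p).symm (extChartAt (𝓡 4) p p) with hq
  have hqp : q = p := extChartAt_to_inv p
  set D : E4 →L[ℝ] E4 :=
    mfderiv 𝓘(ℝ, E4) (𝓡 4) (extChartAt (𝓡 4) p).symm (extChartAt (𝓡 4) p p)
  have hD : ∀ v, D (coords p v) = v := mfderiv_chart_symm_coords p
  -- The base point φ⁻¹(φ p) equals p only propositionally. Viewing all tangent spaces as `E4` lets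
  -- the metric be rewritten along this equality.
  set β : M → E4 →L[ℝ] E4 →L[ℝ] ℝ := fun q ↦ g.inner q
  have hβ : ∀ v w : E4, β q v w = β p v w := fun v w ↦ by rw [hqp]
  have hx : ∀ x : E4, D x = ∑ a, x a • D (EuclideanSpace.single a 1) := fun x ↦ by
    have : x = ∑ a, x a • (EuclideanSpace.single a (1 : ℝ) : E4) := by
      ext i
      simp [Finset.sum_apply, Pi.single_apply]
    conv_lhs => rw [this]
    rw [map_sum]
    simp only [map_smul]
  have key : ∀ x y : E4, ∑ a, ∑ b, β q (D (EuclideanSpace.single a 1))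
      (D (EuclideanSpace.single b 1)) * x a * y b = β q (D x) (D y) := fun x y ↦ by
    rw [hx x, hx y]
    simp only [map_sum, map_smul, _root_.sum_apply, _root_.smul_apply,
      smul_eq_mul, Finset.mul_sum]
    rw [Finset.sum_comm]
    refine Finset.sum_congr rfl fun a _ ↦ Finset.sum_congr rfl fun b _ ↦ ?_
    ring
  exact (key _ _).trans ((hβ _ _).trans
    (congrArg₂ (fun v w : E4 ↦ β p v w) (hD (e i)) (hD (e j))))

lemma frameComp₂_chartMetric_eq_minkowski {p : M} {e : Fin 4 → TangentSpace (𝓡 4) p}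
    (he : g.IsOrthonormalFrame p e) (i j : Fin 4) :
    frameComp₂ (fun i a ↦ coords p (e i) a) (g.chartMetric p (extChartAt (𝓡 4) p p)) i j
      = minkowski i j := by
  rw [g.frameComp₂_chartMetric, he]

lemma isMetricGerm_chartMetric (p : M) :
    IsMetricGerm (g.chartMetric p) (extChartAt (𝓡 4) p p) := by
  refine ⟨fun i j ↦ (g.contDiffAt_chartMetric (mem_extChartAt_target p) i j).of_le
    (WithTop.coe_le_coe.mpr (le_top : (3 : ℕ∞) ≤ ⊤)), Filter.Eventually.of_forall (g.chartMetric_symm p), ?_⟩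
  obtain ⟨e, he⟩ := g.signature p
  set F : Matrix (Fin 4) (Fin 4) ℝ := Matrix.of fun i a ↦ coords p (e i) a with hF
  have h : F * g.chartMetric p (extChartAt (𝓡 4) p p) * F.transpose = minkowski := by
    ext i j
    rw [hF, of_mul_mul_transpose_apply, frameComp₂_chartMetric, he]
  intro h0
  have := congrArg Matrix.det h
  rw [Matrix.det_mul, Matrix.det_mul, h0] at this
  simp [minkowski, Fin.prod_univ_four] at this

lemma pd_comp_chart {n : ℕ} {p : M} {z : E4} (hz : z ∈ (extChartAt (𝓡 4) p).target)
    {ι : M → EuclideanSpace ℝ (Fin n)}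
    (hι : MDifferentiableAt (𝓡 4) 𝓘(ℝ, EuclideanSpace ℝ (Fin n)) ι ((extChartAt (𝓡 4) p).symm z))
    (i : Fin 4) (k : Fin n) :
    pd i (fun x ↦ ι ((extChartAt (𝓡 4) p).symm x) k) z
      = @WithLp.ofLp 2 (Fin n → ℝ) (mfderiv (𝓡 4) 𝓘(ℝ, EuclideanSpace ℝ (Fin n)) ι
        ((extChartAt (𝓡 4) p).symm z) (mfderiv 𝓘(ℝ, E4) (𝓡 4) (extChartAt (𝓡 4) p).symm z
          (EuclideanSpace.single i 1))) k := by
  have hs := mdifferentiableAt_chart_symm hz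
  have hd : DifferentiableAt ℝ (fun x ↦ ι ((extChartAt (𝓡 4) p).symm x)) z :=
    (hι.comp z hs).differentiableAt
  have h := mfderiv_comp_apply z hι hs (EuclideanSpace.single i (1 : ℝ) : E4)
  rw [← h, mfderiv_eq_fderiv]
  have h2 := (EuclideanSpace.proj (𝕜 := ℝ) k).hasFDerivAt.comp z hd.hasFDerivAt
  exact congrArg (fun L : E4 →L[ℝ] ℝ ↦ L (EuclideanSpace.single i 1)) h2.fderiv

lemma exists_riemann_of_admitsClassOneNear {p : M} (hp : g.AdmitsClassOneNear p) :
    ∃ (κ : ℝ) (h θ : Fin 4 → Fin 4 → ℝ), (∀ a b, h a b = h b a) ∧ (∀ a b, θ a b = θ b a) ∧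
      ∀ a b c d, riemann (g.chartMetric p) a b c d (extChartAt (𝓡 4) p p)
        = κ * (h a d * h b c - h b d * h a c) +
        (g.chartMetric p (extChartAt (𝓡 4) p p) a c * θ b d
          - g.chartMetric p (extChartAt (𝓡 4) p p) a d * θ b c
          - g.chartMetric p (extChartAt (𝓡 4) p p) b c * θ a d
          + g.chartMetric p (extChartAt (𝓡 4) p p) b d * θ a c) := by
  obtain ⟨r, s, hrs, U, hU, hpU, ι, Ω, hι⟩ := hp
  set φ := extChartAt (𝓡 4) p with hφ
  have hp' : φ.symm (φ p) = p := extChartAt_to_inv p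
  have hφs : ContMDiffAt 𝓘(ℝ, E4) (𝓡 4) ∞ φ.symm (φ p) :=
    (contMDiffOn_extChartAt_symm (n := ∞) p).contMDiffAt (extChartAt_target_mem_nhds p)
  have hev : ∀ᶠ z in 𝓝 (φ p), z ∈ φ.target ∧ φ.symm z ∈ U :=
    Filter.Eventually.and (extChartAt_target_mem_nhds p) (hφs.continuousAt.eventually_mem (by
      rw [hp']; exact hU.mem_nhds hpU))
  have hιs : ContDiffAt ℝ ∞ (fun z ↦ ι (φ.symm z)) (φ p) := by
    have h1 : ContMDiffAt (𝓡 4) 𝓘(ℝ, EuclideanSpace ℝ (Fin (r + s))) ∞ ι (φ.symm (φ p)) := by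
      rw [hp']; exact hι.smooth.contMDiffAt (hU.mem_nhds hpU)
    exact (h1.comp _ hφs).contDiffAt
  have hΩs : ContDiffAt ℝ ∞ (fun z ↦ Ω (φ.symm z)) (φ p) := by
    have h1 : ContMDiffAt (𝓡 4) 𝓘(ℝ, ℝ) ∞ Ω (φ.symm (φ p)) := by
      rw [hp']; exact hι.smooth_factor.contMDiffAt (hU.mem_nhds hpU)
    exact (h1.comp _ hφs).contDiffAt
  have hΩp : 0 < Ω (φ.symm (φ p)) := by rw [hp']; exact hι.factor_pos p hpU
  have h4 : (4 : WithTop ℕ∞) ≤ ∞ := WithTop.coe_le_coe.mpr (le_top : (4 : ℕ∞) ≤ ⊤)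
  -- Scaling the lift by Ω⁻¹ makes the induced form g itself, so conformal invariance of the Weyl
  -- tensor is never needed.
  refine exists_riemann_of_conformal_immersion (K := Fin (r + s))
    (s := fun i ↦ if (i : ℕ) < r then 1 else -1) (u := fun k z ↦ ι (φ.symm z) k)
    (f := fun z ↦ (Ω (φ.symm z))⁻¹) (by simp [hrs]) (g.isMetricGerm_chartMetric p)
    (fun k ↦ ?_) ((hΩs.inv hΩp.ne').of_le h4) (inv_ne_zero hΩp.ne') ?_
  · exact ((contDiffAt_euclidean.mp hιs) k).of_le h4
  · filter_upwards [hev] with z hz i j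
    have hd : MDifferentiableAt (𝓡 4) 𝓘(ℝ, EuclideanSpace ℝ (Fin (r + s))) ι (φ.symm z) :=
      (hι.smooth.contMDiffAt (hU.mem_nhds hz.2)).mdifferentiableAt (by simp)
    have hpull := hι.pullback _ hz.2
      (mfderiv 𝓘(ℝ, E4) (𝓡 4) φ.symm z (EuclideanSpace.single i 1))
      (mfderiv 𝓘(ℝ, E4) (𝓡 4) φ.symm z (EuclideanSpace.single j 1))
    have hΩ := (hι.factor_pos _ hz.2).ne'
    have hpd : ∀ i k, pd i (fun x ↦ ι (φ.symm x) k) z = _ := pd_comp_chart hz.1 hd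
    have hsum : ∑ k : Fin (r + s), (if (k : ℕ) < r then (1 : ℝ) else -1)
        * pd i (fun x ↦ ι (φ.symm x) k) z * pd j (fun x ↦ ι (φ.symm x) k) z
        = Ω (φ.symm z) ^ 2 * g.chartMetric p z i j :=
      (Finset.sum_congr rfl fun k _ ↦ by rw [hpd i k, hpd j k]).trans hpull
    simp only [hsum]
    rw [← mul_assoc, ← mul_pow, inv_mul_cancel₀ hΩ, one_pow, one_mul]

/-- The covectors η_aa g(e_a, ·) form the dual coframe, so the form is the sum of T_ab times their
tensor products. -/
lemma exists_bilinForm_of_components {p : M} {e : Fin 4 → TangentSpace (𝓡 4) p}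
    (he : g.IsOrthonormalFrame p e) {T : Fin 4 → Fin 4 → ℝ} (hT : ∀ a b, T a b = T b a) :
    ∃ σ : LinearMap.BilinForm ℝ (TangentSpace (𝓡 4) p),
      (∀ v w, σ v w = σ w v) ∧ ∀ i j, σ (e i) (e j) = T i j := by
  refine ⟨∑ a, ∑ b, (T a b * minkowski a a * minkowski b b) •
    LinearMap.BilinForm.linMulLin (g.inner p (e a)).toLinearMap (g.inner p (e b)).toLinearMap,
    fun v w ↦ ?_, fun i j ↦ ?_⟩
  · simp only [LinearMap.sum_apply, LinearMap.smul_apply, smul_eq_mul,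
      LinearMap.BilinForm.linMulLin_apply]
    rw [Finset.sum_comm]
    refine Finset.sum_congr rfl fun a _ ↦ Finset.sum_congr rfl fun b _ ↦ ?_
    rw [hT]
    ring
  · simp only [LinearMap.sum_apply, LinearMap.smul_apply, smul_eq_mul,
      LinearMap.BilinForm.linMulLin_apply, ContinuousLinearMap.coe_coe, he _ _]
    fin_cases i <;> fin_cases j <;> simp [minkowski, Fin.sum_univ_four]

/-- In an orthonormal frame, the algebraic Gauss condition is solvable exactly when the invariants
of the Weyl spinor are real. -/
lemma exists_solvesGauss_iff {ε : ℝ} (hε : ε ≠ 0) {p : M} {e : Fin 4 → TangentSpace (𝓡 4) p}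
    (he : g.IsOrthonormalFrame p e) :
    (∃ σ : LinearMap.BilinForm ℝ (TangentSpace (𝓡 4) p), g.SolvesGauss ε p e σ) ↔
      (invI (g.weylSpinorAt p e)).im = 0 ∧ (invJ (g.weylSpinorAt p e)).im = 0 := by
  constructor
  · rintro ⟨σ, hσ⟩
    refine im_invariants_eq_zero_of_symmetrize (fun a b ↦ hσ.symm (e a) (e b)) hσ.traceFree
      (c := -2 * ε) (mul_ne_zero (by norm_num) hε) fun A B C D ↦ ?_
    rw [hσ.gauss]
    push_cast
    rfl
  · rintro ⟨hI, hJ⟩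
    obtain ⟨X, hX, -, hXT, hX'⟩ :=
      ((g.isMetricGerm_chartMetric p).isAlgebraicWeyl
        (g.frameComp₂_chartMetric_eq_minkowski he)).exists_weylSpinor_eq
    have hX : g.weylSpinorAt p e = pairSpinor X := hX
    rw [hX] at hI hJ
    obtain ⟨T, hT, htr, hg⟩ := exists_tensor_of_im_invariants_eq_zero hXT hX' hI hJ (-2 * ε)
    obtain ⟨σ, hsymm, hσ⟩ := g.exists_bilinForm_of_components he hT
    refine ⟨σ, hsymm, by simpa only [hσ] using htr, fun A B C D ↦ ?_⟩
    simp only [hσ]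
    rw [hg, hX]
    push_cast
    rfl

/-- A class-one conformal embedding near `p` forces the invariants of the Weyl spinor at `p` to be
real. -/
lemma im_invariants_eq_zero_of_admitsClassOneNear {p : M} (hp : g.AdmitsClassOneNear p)
    {e : Fin 4 → TangentSpace (𝓡 4) p} (he : g.IsOrthonormalFrame p e) :
    (invI (g.weylSpinorAt p e)).im = 0 ∧ (invJ (g.weylSpinorAt p e)).im = 0 := by
  obtain ⟨κ, h, θ, hh, hθ, hR⟩ := g.exists_riemann_of_admitsClassOneNear hp
  exact (g.isMetricGerm_chartMetric p).im_invariants_eq_zero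
    (g.frameComp₂_chartMetric_eq_minkowski he) hh hθ hR

end LorentzMetric

end ConfEmb

end

theorem proposition2p4 {M : Type*} [TopologicalSpace M] [ChartedSpace ConfEmb.E4 M]
    [IsManifold (𝓡 4) ∞ M] (g : ConfEmb.LorentzMetric M) :
    (∀ ε : ℝ, (ε = 1 ∨ ε = -1) →
      ∀ (p : M) (e : Fin 4 → TangentSpace (𝓡 4) p), g.IsOrthonormalFrame p e →
        ((∃ σ : LinearMap.BilinForm ℝ (TangentSpace (𝓡 4) p), g.SolvesGauss ε p e σ) ↔
          (ConfEmb.invI (g.weylSpinorAt p e)).im = 0 ∧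
            (ConfEmb.invJ (g.weylSpinorAt p e)).im = 0)) ∧
    (∀ p : M, g.AdmitsClassOneNear p →
      ∀ e : Fin 4 → TangentSpace (𝓡 4) p, g.IsOrthonormalFrame p e →
        (ConfEmb.invI (g.weylSpinorAt p e)).im = 0 ∧
          (ConfEmb.invJ (g.weylSpinorAt p e)).im = 0) := by
  exact ⟨fun ε hε p e he ↦ g.exists_solvesGauss_iff (by rcases hε with rfl | rfl <;> norm_num) he,
    fun p hp e he ↦ g.im_invariants_eq_zero_of_admitsClassOneNear hp he⟩
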